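/- Let $(M,g_M)$ be a Riemannian manifold of dimension $m$ and $(N,g_N,P)$ a Kähler manifold of real dimension $n$ (smooth, without boundary), with Levi-Civita connections $\nabla^M$, $\nabla^N$; that is, $P$ is a smooth $(1,1)$-tensor field on $N$ with $P^2=-I$, $g_N(P\cdot,P\cdot)=g_N$ and $\nabla^N P=0$. Let $F:M\to N$ be a smooth map with differential $F_*$, and suppose: 1. ($F$ is a Riemannian map.) For every $q\in M$, $0<\operatorname{rank}F_{*q}<\min\{m,n\}$ and $g_N(F_*X,F_*Y)=g_M(X,Y)$ for all $X,Y\in(\ker F_{*q})^\perp$. 2. ($F$ is semi-invariant.) There are smooth subbundles $D_1,D_2$ of $F^{-1}TN$ with $\operatorname{range}F_*=D_1\oplus D_2$, $P(D_1)=D_1$ and $P(D_2)\subseteq(\operatorname{range}F_*)^\perp$. 3. (Range distribution.) $\operatorname{range}F_*$ is given as a smooth distribution $R$ on an open set $W\subseteq N$ containing $F(M)$, i.e. $R_{F(q)}=F_{*q}(T_qM)$ for all $q\in M$, and $R^\perp$ is totally geodesic on $W$: $\nabla^N_UV$ is a section of $R^\perp$ for all smooth sections $U,V$ of $R^\perp$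 over $W$. 4. (Clairaut relation with $s=e^f$.) $f:N\to\mathbb R$ is smooth and, for every geodesic $\beta$ of $N$ lying in $W$, the function $t\mapsto e^{f(\beta(t))}\sin\theta(t)$ is constant, where $\theta(t)$ is the angle between $\dot\beta(t)$ and its component in $R^\perp$ ($\theta(t)=\pi/2$ if that component vanishes). Such an $F$ is called a Clairaut semi-invariant Riemannian map (CSIRM) with $s=e^f$. For $u\in\operatorname{range}F_*$ write $Pu=\phi u+\omega u$, and for $V\in(\operatorname{range}F_*)^\perp$ write $PV=BV+CV$, where $\phi u,BV\in\operatorname{range}F_*$ and $\omega u,CV\in(\operatorname{range}F_*)^\perp$. Let $\nabla^F$ be the pullback to $F^{-1}TN$ of $\nabla^N$; for a section $V$ of $(\operatorname{range}F_*)^\perp$ along $F$ let $\nabla^{F\perp}_XV$ be the component of $\nabla^F_XV$ in $(\operatorname{range}F_*)^\perp$. The map $F$ is totally geodesic if $(\nabla F_*)(X,Y)=\nabla^F_XF_*Y-F_*(\nabla^M_XY)$ vanishes for all smooth vector fields $X,Y$ on $M$. A distribution $S$ on $M$ is totally geodesic if $\nabla^M_XY\in\Gamma(S)$ for all $X,Y\in\Gamma(S)$.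 **Theorem.** Let $F$ be a CSIRM with $s=e^f$ such that $\dim D_2>1$ (at every point). Then $F$ is totally geodesic if and only if (i) $\ker F_*$ is totally geodesic, and (ii) $(\ker F_*)^\perp$ is totally geodesic, and (iii) for all smooth sections $X,Y,Z\in\Gamma((\ker F_*)^\perp)$ with $F_*Z=\phi F_*Y$, $$g_M(X,Z)\{B(\nabla^Nf)+C(\nabla^Nf)\}=\phi F_*(\nabla^M_XZ)+\omega F_*(\nabla^M_XZ)+B\nabla^{F\perp}_X\omega F_*Y+C\nabla^{F\perp}_X\omega F_*Y+F_*(\nabla^M_XY).$$ -/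

import Mathlib

open Bundle Manifold Set
open scoped ContDiff Topology

namespace RiemGeom
noncomputable section
section LeviCivita
variable {E : Type*} [NormedAddCommGroup E] [NormedSpace ℝ E] [FiniteDimensional ℝ E]
  {H : Type*} [TopologicalSpace H] {I : ModelWithCorners ℝ E H}
  {M : Type*} [TopologicalSpace M] [ChartedSpace H M] [IsManifold I ∞ M]
  [RiemannianBundle (fun x : M => TangentSpace I x)]
  [IsContMDiffRiemannianBundle I ∞ E (fun x : M => TangentSpace I x)]

instance (x : M) : FiniteDimensional ℝ (TangentSpace I x) := inferInstanceAs (FiniteDimensional ℝ E)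
instance (x : M) : CompleteSpace (TangentSpace I x) := FiniteDimensional.complete ℝ _

/-! ### The Levi-Civita connection, built from the Koszul formula -/

/-- A connection on the tangent bundle is a Levi-Civita connection if it is torsion-free and
compatible with the metric. -/
def IsLeviCivita (cov : CovariantDerivative I E (fun x : M => TangentSpace I x)) : Prop :=
  haveI : CompleteSpace E := FiniteDimensional.complete ℝ E
  cov.torsion = 0 ∧ cov.IsMetricCompatible

theorem mdifferentiableAt_inner {x : M} {Y Z : Π x : M, TangentSpace I x}
    (hY : MDiffAt (T% Y) x) (hZ : MDiffAt (T% Z) x) :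
    MDiffAt (fun y => inner ℝ (Y y) (Z y)) x :=
  MDifferentiableAt.inner_bundle (IB := I) (F := E) (E := fun x : M => TangentSpace I x)
    (b := fun y => y) hY hZ

/-- The right-hand side of the Koszul formula for `2 ⟨∇_X Y, Z⟩` at `x`. -/
def koszul (Y X Z : Π x : M, TangentSpace I x) (x : M) : ℝ :=
  mvfderiv I (fun y => inner ℝ (Y y) (Z y)) x (X x)
  + mvfderiv I (fun y => inner ℝ (Z y) (X y)) x (Y x)
  - mvfderiv I (fun y => inner ℝ (X y) (Y y)) x (Z x)
  + inner ℝ (VectorField.mlieBracket I X Y x) (Z x)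
  - inner ℝ (VectorField.mlieBracket I Y Z x) (X x)
  + inner ℝ (VectorField.mlieBracket I Z X x) (Y x)

theorem koszul_tensorial₁ {x : M} {Y Z : Π x : M, TangentSpace I x}
    (hY : MDiffAt (T% Y) x) (hZ : MDiffAt (T% Z) x) :
    TensorialAt I E (fun X => koszul Y X Z x) x where
  smul {f X} hf hX := by
    have := FiniteDimensional.complete ℝ E
    have e1 : (fun y => inner ℝ (Z y) ((f • X) y)) = f * (fun y => inner ℝ (Z y) (X y)) := by
      ext y; simp [inner_smul_right]
    have e2 : (fun y => inner ℝ ((f • X) y) (Y y)) = f * (fun y => inner ℝ (X y) (Y y)) := by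
      ext y; simp [inner_smul_left]
    simp only [koszul]
    rw [e1, e2, mvfderiv_mul hf (mdifferentiableAt_inner hZ hX), mvfderiv_mul hf (mdifferentiableAt_inner hX hY),
      VectorField.mlieBracket_smul_left hf hX, VectorField.mlieBracket_smul_right hf hX]
    simp [inner_smul_left, inner_smul_right, inner_add_left, real_inner_comm]
    ring
  add {X X'} hX hX' := by
    have := FiniteDimensional.complete ℝ E
    have e1 : (fun y => inner ℝ (Z y) ((X + X') y)) =
        (fun y => inner ℝ (Z y) (X y)) + (fun y => inner ℝ (Z y) (X' y)) := by
      ext y; simp [inner_add_right]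
    have e2 : (fun y => inner ℝ ((X + X') y) (Y y)) =
        (fun y => inner ℝ (X y) (Y y)) + (fun y => inner ℝ (X' y) (Y y)) := by
      ext y; simp [inner_add_left]
    simp only [koszul]
    rw [e1, e2, mvfderiv_add (mdifferentiableAt_inner hZ hX) (mdifferentiableAt_inner hZ hX'),
      mvfderiv_add (mdifferentiableAt_inner hX hY) (mdifferentiableAt_inner hX' hY),
      VectorField.mlieBracket_add_left hX hX', VectorField.mlieBracket_add_right hX hX']
    simp [inner_add_left, inner_add_right]
    ring

theorem koszul_tensorial₂ {x : M} {Y X : Π x : M, TangentSpace I x}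
    (hY : MDiffAt (T% Y) x) (hX : MDiffAt (T% X) x) :
    TensorialAt I E (fun Z => koszul Y X Z x) x where
  smul {f Z} hf hZ := by
    have := FiniteDimensional.complete ℝ E
    have e1 : (fun y => inner ℝ ((f • Z) y) (X y)) = f * (fun y => inner ℝ (Z y) (X y)) := by
      ext y; simp [inner_smul_left]
    have e2 : (fun y => inner ℝ (Y y) ((f • Z) y)) = f * (fun y => inner ℝ (Y y) (Z y)) := by
      ext y; simp [inner_smul_right]
    simp only [koszul]
    rw [e1, e2, mvfderiv_mul hf (mdifferentiableAt_inner hZ hX), mvfderiv_mul hf (mdifferentiableAt_inner hY hZ),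
      VectorField.mlieBracket_smul_left hf hZ, VectorField.mlieBracket_smul_right hf hZ]
    simp [inner_smul_left, inner_smul_right, inner_add_left, real_inner_comm]
    ring
  add {Z Z'} hZ hZ' := by
    have := FiniteDimensional.complete ℝ E
    have e1 : (fun y => inner ℝ ((Z + Z') y) (X y)) =
        (fun y => inner ℝ (Z y) (X y)) + (fun y => inner ℝ (Z' y) (X y)) := by
      ext y; simp [inner_add_left]
    have e2 : (fun y => inner ℝ (Y y) ((Z + Z') y)) =
        (fun y => inner ℝ (Y y) (Z y)) + (fun y => inner ℝ (Y y) (Z' y)) := by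
      ext y; simp [inner_add_right]
    simp only [koszul]
    rw [e1, e2, mvfderiv_add (mdifferentiableAt_inner hZ hX) (mdifferentiableAt_inner hZ' hX),
      mvfderiv_add (mdifferentiableAt_inner hY hZ) (mdifferentiableAt_inner hY hZ'),
      VectorField.mlieBracket_add_left hZ hZ', VectorField.mlieBracket_add_right hZ hZ']
    simp [inner_add_left, inner_add_right]
    ring

open Classical in
/-- The covariant derivative determined by the Koszul formula. -/
def koszulCov (Y : Π x : M, TangentSpace I x) (x : M) : TangentSpace I x →L[ℝ] TangentSpace I x :=
  if hY : MDiffAt (T% Y) x then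
    let B := TensorialAt.mkHom₂ (fun X Z => koszul Y X Z x) x
      (fun _ hZ => koszul_tensorial₁ hY hZ) (fun _ hX => koszul_tensorial₂ hY hX)
    LinearMap.toContinuousLinearMap
      { toFun := fun v => (1 / 2 : ℝ) • (InnerProductSpace.toDual ℝ (TangentSpace I x)).symm (B v)
        map_add' := fun v w => by simp
        map_smul' := fun c v => by simp [smul_comm c] }
  else 0

theorem inner_koszulCov {x : M} {X Y Z : Π x : M, TangentSpace I x} (hX : MDiffAt (T% X) x)
    (hY : MDiffAt (T% Y) x) (hZ : MDiffAt (T% Z) x) :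
    inner ℝ (koszulCov Y x (X x)) (Z x) = koszul Y X Z x / 2 := by
  rw [koszulCov, dif_pos hY]
  simp only [LinearMap.coe_toContinuousLinearMap', LinearMap.coe_mk, AddHom.coe_mk,
    real_inner_smul_left, InnerProductSpace.toDual_symm_apply]
  rw [TensorialAt.mkHom₂_apply _ _ hX hZ]
  ring

theorem koszulCov_ext {x : M} {A B : TangentSpace I x →L[ℝ] TangentSpace I x}
    (h : ∀ X Z : Π x : M, TangentSpace I x, MDiffAt (T% X) x → MDiffAt (T% Z) x →
      inner ℝ (A (X x)) (Z x) = inner ℝ (B (X x)) (Z x)) : A = B := by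
  ext v
  refine ext_inner_right ℝ fun w => ?_
  have := h (FiberBundle.extend E v) (FiberBundle.extend E w) (FiberBundle.mdifferentiableAt_extend ..)
    (FiberBundle.mdifferentiableAt_extend ..)
  simpa using this

variable (I M) in
/-- The Levi-Civita connection of `M`; `leviCivita I M Y x v` is `∇_v Y` at `x`. -/
def leviCivita : CovariantDerivative I E (fun x : M => TangentSpace I x) where
  toFun := koszulCov
  isCovariantDerivativeOnUniv :=
    { add := by
        intro Y Y' x hY hY' _
        have := FiniteDimensional.complete ℝ E
        have hYY := mdifferentiableAt_add_section hY hY'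
        refine koszulCov_ext fun X Z hX hZ => ?_
        rw [inner_koszulCov hX hYY hZ]
        simp only [add_apply, inner_add_left]
        rw [inner_koszulCov hX hY hZ, inner_koszulCov hX hY' hZ]
        have e1 : (fun y => inner ℝ ((Y + Y') y) (Z y)) =
            (fun y => inner ℝ (Y y) (Z y)) + (fun y => inner ℝ (Y' y) (Z y)) := by
          ext y; simp [inner_add_left]
        have e2 : (fun y => inner ℝ (X y) ((Y + Y') y)) =
            (fun y => inner ℝ (X y) (Y y)) + (fun y => inner ℝ (X y) (Y' y)) := by
          ext y; simp [inner_add_right]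
        simp only [koszul]
        rw [e1, e2, mvfderiv_add (mdifferentiableAt_inner hY hZ) (mdifferentiableAt_inner hY' hZ),
          mvfderiv_add (mdifferentiableAt_inner hX hY) (mdifferentiableAt_inner hX hY'),
          VectorField.mlieBracket_add_left hY hY', VectorField.mlieBracket_add_right hY hY']
        simp [inner_add_left, inner_add_right]
        ring
      leibniz := by
        intro Y f x hY hf _
        have := FiniteDimensional.complete ℝ E
        have hfY := hf.smul_section hY
        refine koszulCov_ext fun X Z hX hZ => ?_
        rw [inner_koszulCov hX hfY hZ]
        simp only [add_apply, inner_add_left, smul_apply,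
          inner_smul_left, ContinuousLinearMap.smulRight_apply]
        rw [inner_koszulCov hX hY hZ]
        have e1 : (fun y => inner ℝ ((f • Y) y) (Z y)) = f * (fun y => inner ℝ (Y y) (Z y)) := by
          ext y; simp [inner_smul_left]
        have e2 : (fun y => inner ℝ (X y) ((f • Y) y)) = f * (fun y => inner ℝ (X y) (Y y)) := by
          ext y; simp [inner_smul_right]
        simp only [koszul]
        rw [e1, e2, mvfderiv_mul hf (mdifferentiableAt_inner hY hZ), mvfderiv_mul hf (mdifferentiableAt_inner hX hY),
          VectorField.mlieBracket_smul_left hf hY, VectorField.mlieBracket_smul_right hf hY]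
        simp [inner_smul_left, inner_smul_right, inner_add_left, real_inner_comm]
        ring }

theorem isLeviCivita_leviCivita : IsLeviCivita (leviCivita I M) := by
  have := FiniteDimensional.complete ℝ E
  refine ⟨?_, ?_⟩
  · rw [CovariantDerivative.torsion_eq_zero_iff]
    intro X Y x hX hY
    change koszulCov Y x (X x) - koszulCov X x (Y x) = _
    refine ext_inner_right ℝ fun w => ?_
    obtain ⟨Z, hZ, rfl⟩ : ∃ Z : Π x : M, TangentSpace I x, MDiffAt (T% Z) x ∧ Z x = w :=
      
      ⟨_, FiberBundle.mdifferentiableAt_extend (I := I) (F := E) w, by simp⟩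
    rw [inner_sub_left, inner_koszulCov hX hY hZ, inner_koszulCov hY hX hZ]
    simp only [koszul]
    rw [VectorField.mlieBracket_swap_apply (V := Y) (W := X),
      VectorField.mlieBracket_swap_apply (V := X) (W := Z),
      VectorField.mlieBracket_swap_apply (V := Z) (W := Y)]
    simp [real_inner_comm]
    ring
  · rw [CovariantDerivative.isMetricCompatible_iff]
    intro x X Y Z hX hY hZ
    change _ = inner ℝ (koszulCov Y x (X x)) (Z x) + inner ℝ (Y x) (koszulCov Z x (X x))
    rw [real_inner_comm (koszulCov Z x (X x)), inner_koszulCov hX hY hZ, inner_koszulCov hX hZ hY]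
    simp only [koszul]
    rw [VectorField.mlieBracket_swap_apply (V := Y) (W := X),
      VectorField.mlieBracket_swap_apply (V := X) (W := Z),
      VectorField.mlieBracket_swap_apply (V := Z) (W := Y)]
    simp [real_inner_comm]
    ring

end LeviCivita

/-! ### Smooth sections, subbundles and totally geodesic distributions -/

section Distributions
variable {E : Type*} [NormedAddCommGroup E] [NormedSpace ℝ E]
  {H : Type*} [TopologicalSpace H] (I : ModelWithCorners ℝ E H)
  {M : Type*} [TopologicalSpace M] [ChartedSpace H M] [IsManifold I ∞ M]
  {E' : Type*} [NormedAddCommGroup E'] [NormedSpace ℝ E']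
  {H' : Type*} [TopologicalSpace H'] (J : ModelWithCorners ℝ E' H')
  {N : Type*} [TopologicalSpace N] [ChartedSpace H' N] [IsManifold J ∞ N]

/-- `X` is a vector field which is smooth on `s`. -/
def IsSmoothFieldOn (X : Π x : M, TangentSpace I x) (s : Set M) : Prop :=
  ContMDiffOn I I.tangent ∞ (fun x => (⟨x, X x⟩ : TangentBundle I M)) s

/-- `σ` is a vector field along `F` (a section of `F⁻¹ TN`) which is smooth on `s`. -/
def IsSmoothFieldAlongOn (F : M → N) (σ : Π q : M, TangentSpace J (F q)) (s : Set M) : Prop :=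
  ContMDiffOn I J.tangent ∞ (fun q => (⟨F q, σ q⟩ : TangentBundle J N)) s

/-- The subspaces `S q` of `T_{F q} N` form, for `q` in `s`, a smooth subbundle of `F⁻¹ TN`: near
every point of `s` they have a smooth frame. -/
def IsSmoothSubbundleOn (F : M → N) (S : Π q : M, Submodule ℝ (TangentSpace J (F q)))
    (s : Set M) : Prop :=
  ∀ q₀ ∈ s, ∃ U : Set M, IsOpen U ∧ q₀ ∈ U ∧
    ∃ (k : ℕ) (σ : Fin k → Π q : M, TangentSpace J (F q)),
      (∀ i, IsSmoothFieldAlongOn I J F (σ i) U) ∧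
      ∀ q ∈ U, LinearIndependent ℝ (fun i => σ i q) ∧
        S q = Submodule.span ℝ (Set.range fun i => σ i q)

variable [FiniteDimensional ℝ E]
  [RiemannianBundle (fun x : M => TangentSpace I x)]
  [IsContMDiffRiemannianBundle I ∞ E (fun x : M => TangentSpace I x)]

/-- The distribution `S` is totally geodesic on `W`: `∇_X Y` is a section of `S` whenever `X` and
`Y` are sections of `S`. -/
def IsTotallyGeodesicOn (S : Π x : M, Submodule ℝ (TangentSpace I x)) (W : Set M) : Prop :=
  ∀ X Y : Π x : M, TangentSpace I x,
    IsSmoothFieldOn I X W → (∀ x ∈ W, X x ∈ S x) →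
    IsSmoothFieldOn I Y W → (∀ x ∈ W, Y x ∈ S x) →
    ∀ x ∈ W, leviCivita I M Y x (X x) ∈ S x

/-- The gradient of `f` at `x`, characterised by `⟨∇f, v⟩ = df v`. -/
def gradient (f : M → ℝ) (x : M) : TangentSpace I x :=
  (InnerProductSpace.toDual ℝ (TangentSpace I x)).symm (mvfderiv I f x)

end Distributions

/-! ### The pullback connection and geodesics -/

section Pullback
variable {E : Type*} [NormedAddCommGroup E] [NormedSpace ℝ E]
  {H : Type*} [TopologicalSpace H] (I : ModelWithCorners ℝ E H)
  {M : Type*} [TopologicalSpace M] [ChartedSpace H M]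
  {E' : Type*} [NormedAddCommGroup E'] [NormedSpace ℝ E'] [FiniteDimensional ℝ E']
  {H' : Type*} [TopologicalSpace H'] (J : ModelWithCorners ℝ E' H')
  {N : Type*} [TopologicalSpace N] [ChartedSpace H' N] [IsManifold J ∞ N]
  [RiemannianBundle (fun y : N => TangentSpace J y)]
  [IsContMDiffRiemannianBundle J ∞ E' (fun y : N => TangentSpace J y)]

/-- The pullback connection on `F⁻¹ TN`: in a local frame `e i` of `TN` near `F q`, the covariant
derivative of `σ = ∑ i, c i • (e i ∘ F)` in the direction `v` is
`∑ i, (dc i v • e i + c i • ∇_{F_* v} e i)`. -/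
def pullbackCov (F : M → N) (σ : Π q : M, TangentSpace J (F q)) (q : M)
    (v : TangentSpace I q) : TangentSpace J (F q) :=
  let e := trivializationAt E' (fun y : N => TangentSpace J y) (F q)
  let b := Module.finBasis ℝ E'
  ∑ i, (mvfderiv I (fun p => e.localFrameCoeff J b i (F p) (σ p)) q v • e.localFrame b i (F q)
    + e.localFrameCoeff J b i (F q) (σ q) •
        leviCivita J N (e.localFrame b i) (F q) (mfderiv I J F q v))

/-- The velocity of a curve. -/
def velocity (β : ℝ → N) (t : ℝ) : TangentSpace J (β t) :=
  mfderiv 𝓘(ℝ, ℝ) J β t (1 : ℝ)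

/-- `β` is a geodesic on the interval `(a, b)`. -/
def IsGeodesicOn (β : ℝ → N) (a b : ℝ) : Prop :=
  ContMDiffOn 𝓘(ℝ, ℝ) J 2 β (Ioo a b) ∧
    ∀ t ∈ Ioo a b, pullbackCov 𝓘(ℝ, ℝ) J β (velocity J β) t (1 : ℝ) = 0

/-- An almost complex structure `P` making `N` a Kähler manifold: a smooth tensor field of type
`(1, 1)` with `P² = -1`, orthogonal for the metric, and parallel. -/
structure IsKahler (P : Π y : N, TangentSpace J y →L[ℝ] TangentSpace J y) : Prop where
  smooth : ContMDiff J (J.prod 𝓘(ℝ, E' →L[ℝ] E')) ∞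
    (fun y => TotalSpace.mk' (E' →L[ℝ] E')
      (E := fun y : N => TangentSpace J y →L[ℝ] TangentSpace J y) y (P y))
  sq : ∀ (y : N) (v : TangentSpace J y), P y (P y v) = -v
  inner_eq : ∀ (y : N) (v w : TangentSpace J y), inner ℝ (P y v) (P y w) = inner ℝ v w
  parallel : ∀ Y : Π y : N, TangentSpace J y, IsSmoothFieldOn J Y univ →
    ∀ (y : N) (v : TangentSpace J y),
      leviCivita J N (fun z => P z (Y z)) y v = P y (leviCivita J N Y y v)

end Pullback

/-! ### Riemannian maps -/

section Maps
variable {E : Type*} [NormedAddCommGroup E] [NormedSpace ℝ E] [FiniteDimensional ℝ E]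
  {H : Type*} [TopologicalSpace H] (I : ModelWithCorners ℝ E H)
  {M : Type*} [TopologicalSpace M] [ChartedSpace H M] [IsManifold I ∞ M]
  [RiemannianBundle (fun x : M => TangentSpace I x)]
  [IsContMDiffRiemannianBundle I ∞ E (fun x : M => TangentSpace I x)]
  {E' : Type*} [NormedAddCommGroup E'] [NormedSpace ℝ E'] [FiniteDimensional ℝ E']
  {H' : Type*} [TopologicalSpace H'] (J : ModelWithCorners ℝ E' H')
  {N : Type*} [TopologicalSpace N] [ChartedSpace H' N] [IsManifold J ∞ N]
  [RiemannianBundle (fun y : N => TangentSpace J y)]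
  [IsContMDiffRiemannianBundle J ∞ E' (fun y : N => TangentSpace J y)]

/-- `ker F_*` at `q`. -/
def kerSpace (F : M → N) (q : M) : Submodule ℝ (TangentSpace I q) :=
  LinearMap.ker (mfderiv I J F q).toLinearMap

/-- `(ker F_*)^⊥` at `q`. -/
def horSpace (F : M → N) (q : M) : Submodule ℝ (TangentSpace I q) := (kerSpace I J F q)ᗮ

/-- `range F_*` at `q`, a subspace of `T_{F q} N`. -/
def rangeSpace (F : M → N) (q : M) : Submodule ℝ (TangentSpace J (F q)) :=
  LinearMap.range (mfderiv I J F q).toLinearMap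

/-- The component of `v` in `range F_*`. -/
def tanPart (F : M → N) (q : M) (v : TangentSpace J (F q)) : TangentSpace J (F q) :=
  (rangeSpace I J F q).starProjection v

/-- The component of `v` in `(range F_*)^⊥`. -/
def norPart (F : M → N) (q : M) (v : TangentSpace J (F q)) : TangentSpace J (F q) :=
  (rangeSpace I J F q)ᗮ.starProjection v

/-- `F` is a Riemannian map with `0 < rank F < min (dim M) (dim N)`: `F_*` is isometric on
`(ker F_*)^⊥`. -/
structure IsRiemannianMap (F : M → N) : Prop where
  smooth : ContMDiff I J ∞ F
  rank_pos : ∀ q, 0 < Module.finrank ℝ (rangeSpace I J F q)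
  rank_lt : ∀ q, Module.finrank ℝ (rangeSpace I J F q) <
    min (Module.finrank ℝ E) (Module.finrank ℝ E')
  inner_eq : ∀ q, ∀ x ∈ horSpace I J F q, ∀ y ∈ horSpace I J F q,
    inner ℝ (mfderiv I J F q x) (mfderiv I J F q y) = inner ℝ x y

/-- The second fundamental form `(∇F_*)(X, Y) = ∇^F_X F_* Y - F_* (∇^M_X Y)`. -/
def secondFundForm (F : M → N) (X Y : Π q : M, TangentSpace I q) (q : M) :
    TangentSpace J (F q) :=
  pullbackCov I J F (fun p => mfderiv I J F p (Y p)) q (X q)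
    - mfderiv I J F q (leviCivita I M Y q (X q))

/-- `F` is totally geodesic: `∇F_* = 0`. -/
def IsTotallyGeodesicMap (F : M → N) : Prop :=
  ∀ X Y : Π q : M, TangentSpace I q, IsSmoothFieldOn I X univ → IsSmoothFieldOn I Y univ →
    ∀ q, secondFundForm I J F X Y q = 0

/-- The connection `∇^{F⊥}` on `(range F_*)^⊥`. -/
def normalCov (F : M → N) (V : Π q : M, TangentSpace J (F q)) (q : M) (v : TangentSpace I q) :
    TangentSpace J (F q) :=
  norPart I J F q (pullbackCov I J F V q v)

/-- `F` is semi-invariant with distributions `D₁`, `D₂`: `range F_* = D₁ ⊕ D₂`, where `D₁` and `D₂`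
are smooth subbundles, `P D₁ = D₁` and `P D₂ ⊆ (range F_*)^⊥` (so that `D₁ ⊥ D₂`). -/
structure IsSemiInvariant (P : Π y : N, TangentSpace J y →L[ℝ] TangentSpace J y) (F : M → N)
    (D₁ D₂ : Π q : M, Submodule ℝ (TangentSpace J (F q))) : Prop where
  smooth₁ : IsSmoothSubbundleOn I J F D₁ univ
  smooth₂ : IsSmoothSubbundleOn I J F D₂ univ
  sup_eq : ∀ q, D₁ q ⊔ D₂ q = rangeSpace I J F q
  map₁ : ∀ q, (D₁ q).map (P (F q)).toLinearMap = D₁ q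
  map₂ : ∀ q, (D₂ q).map (P (F q)).toLinearMap ≤ (rangeSpace I J F q)ᗮ

section
variable (P : Π y : N, TangentSpace J y →L[ℝ] TangentSpace J y) (F : M → N) (q : M)

/-- `φ u`, the component of `P u` in `range F_*`, for `u` in `range F_*`. -/
def phi (u : TangentSpace J (F q)) : TangentSpace J (F q) := tanPart I J F q (P (F q) u)

/-- `ω u`, the component of `P u` in `(range F_*)^⊥`, for `u` in `range F_*`. -/
def omega (u : TangentSpace J (F q)) : TangentSpace J (F q) := norPart I J F q (P (F q) u)

/-- `B V`, the component of `P V` in `range F_*`, for `V` in `(range F_*)^⊥`. -/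
def opB (V : TangentSpace J (F q)) : TangentSpace J (F q) := tanPart I J F q (P (F q) V)

/-- `C V`, the component of `P V` in `(range F_*)^⊥`, for `V` in `(range F_*)^⊥`. -/
def opC (V : TangentSpace J (F q)) : TangentSpace J (F q) := norPart I J F q (P (F q) V)
end

/-- `R` is a smooth distribution on the open set `W ⊇ F(M)` of `N` whose value at `F q` is
`F_{*q}(T_q M)`. It is the distribution on (an open part of) `N` that is denoted `range F_*`. -/
structure IsRangeDistribution (F : M → N) (W : Set N)
    (R : Π y : N, Submodule ℝ (TangentSpace J y)) : Prop where
  isOpen : IsOpen W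
  mem : ∀ q, F q ∈ W
  smooth : IsSmoothSubbundleOn J J (fun y : N => y) R W
  apply_eq : ∀ q, R (F q) = rangeSpace I J F q

/-- The Clairaut relation for `s = e^f`: along every geodesic `β` in `W`, the function
`s(β(t)) sin θ(t)` is constant, where `θ(t)` is the angle between `β'(t)` and its component in
`R^⊥`. (The angle with the zero vector is `π / 2`.) -/
def ClairautRelation (W : Set N) (R : Π y : N, Submodule ℝ (TangentSpace J y))
    (f : N → ℝ) : Prop :=
  ∀ (a b : ℝ) (β : ℝ → N), IsGeodesicOn J β a b → (∀ t ∈ Ioo a b, β t ∈ W) →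
    ∃ c : ℝ, ∀ t ∈ Ioo a b,
      Real.exp (f (β t)) *
        Real.sin (InnerProductGeometry.angle (velocity J β t)
          ((R (β t))ᗮ.starProjection (velocity J β t))) = c

/-- `F` is a Clairaut semi-invariant Riemannian map with `s = e^f` to the Kähler manifold
`(N, P)`. -/
structure IsCSIRM (P : Π y : N, TangentSpace J y →L[ℝ] TangentSpace J y) (F : M → N)
    (D₁ D₂ : Π q : M, Submodule ℝ (TangentSpace J (F q)))
    (W : Set N) (R : Π y : N, Submodule ℝ (TangentSpace J y)) (f : N → ℝ) : Prop where
  kahler : IsKahler J P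
  riemannian : IsRiemannianMap I J F
  semiInvariant : IsSemiInvariant I J P F D₁ D₂
  rangeDistribution : IsRangeDistribution I J F W R
  smooth : ContMDiff J 𝓘(ℝ, ℝ) ∞ f
  clairaut : ClairautRelation J W R f

end Maps
end
end RiemGeom

set_option linter.unusedSectionVars false

namespace RiemGeom
noncomputable section

section Along
variable {E : Type*} [NormedAddCommGroup E] [NormedSpace ℝ E]
  {H : Type*} [TopologicalSpace H] {I : ModelWithCorners ℝ E H}
  {M : Type*} [TopologicalSpace M] [ChartedSpace H M]
  {E' : Type*} [NormedAddCommGroup E'] [NormedSpace ℝ E']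
  {H' : Type*} [TopologicalSpace H'] {J : ModelWithCorners ℝ E' H'}
  {N : Type*} [TopologicalSpace N] [ChartedSpace H' N] [IsManifold J ∞ N]
  {F : M → N} {q : M}

variable (I J) in
/-- The vector field `σ` along `F` is smooth at `q`. -/
def SmoothAlongAt (F : M → N) (σ : Π q : M, TangentSpace J (F q)) (q : M) : Prop :=
  ContMDiffAt I J.tangent ∞ (fun q => (⟨F q, σ q⟩ : TangentBundle J N)) q

variable (I J) in
/-- The vector field `σ` along `F` is differentiable at `q`. -/
def MDiffAlongAt (F : M → N) (σ : Π q : M, TangentSpace J (F q)) (q : M) : Prop :=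
  MDifferentiableAt I J.tangent (fun q => (⟨F q, σ q⟩ : TangentBundle J N)) q

variable {σ τ : Π q : M, TangentSpace J (F q)} {c : M → ℝ}

theorem SmoothAlongAt.mdiffAlongAt (h : SmoothAlongAt I J F σ q) : MDiffAlongAt I J F σ q :=
  ContMDiffAt.mdifferentiableAt h (by simp)

theorem IsSmoothFieldAlongOn.smoothAlongAt {s : Set M} (h : IsSmoothFieldAlongOn I J F σ s)
    (hs : s ∈ 𝓝 q) : SmoothAlongAt I J F σ q :=
  ContMDiffOn.contMDiffAt h hs

theorem IsSmoothFieldAlongOn.of_smoothAlongAt {s : Set M}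
    (h : ∀ q ∈ s, SmoothAlongAt I J F σ q) : IsSmoothFieldAlongOn I J F σ s :=
  fun q hq => (h q hq).contMDiffWithinAt

theorem smoothAlongAt_iff :
    SmoothAlongAt I J F σ q ↔ ContMDiffAt I J ∞ F q ∧ ContMDiffAt I 𝓘(ℝ, E') ∞
      (fun p => (trivializationAt E' (TangentSpace J) (F q) (⟨F p, σ p⟩ : TangentBundle J N)).2)
      q :=
  contMDiffAt_totalSpace

theorem mdiffAlongAt_iff :
    MDiffAlongAt I J F σ q ↔ MDifferentiableAt I J F q ∧ MDifferentiableAt I 𝓘(ℝ, E')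
      (fun p => (trivializationAt E' (TangentSpace J) (F q) (⟨F p, σ p⟩ : TangentBundle J N)).2)
      q :=
  mdifferentiableAt_totalSpace ..

theorem mdiffAlongAt_iff_of_mem (e : Trivialization E' (TotalSpace.proj : TangentBundle J N → N))
    [MemTrivializationAtlas e] (he : F q ∈ e.baseSet) :
    MDiffAlongAt I J F σ q ↔ MDifferentiableAt I J F q ∧ MDifferentiableAt I 𝓘(ℝ, E')
      (fun p => (e (⟨F p, σ p⟩ : TangentBundle J N)).2) q :=
  e.mdifferentiableAt_totalSpace_iff J _ (e.mem_source.2 he)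

theorem eventually_mem_baseSet_of_continuousAt (hF : ContinuousAt F q) :
    ∀ᶠ p in 𝓝 q, F p ∈ (trivializationAt E' (TangentSpace J : N → Type _) (F q)).baseSet :=
  hF ((trivializationAt E' (TangentSpace J) (F q)).open_baseSet.mem_nhds
    (mem_baseSet_trivializationAt ..))

theorem triv_add {e : Trivialization E' (TotalSpace.proj : TangentBundle J N → N)}
    [MemTrivializationAtlas e] {y : N} (hy : y ∈ e.baseSet) (v w : TangentSpace J y) :
    (e (⟨y, v + w⟩ : TangentBundle J N)).2 = (e ⟨y, v⟩).2 + (e ⟨y, w⟩).2 :=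
  (e.linear ℝ hy).map_add v w

theorem triv_smul {e : Trivialization E' (TotalSpace.proj : TangentBundle J N → N)}
    [MemTrivializationAtlas e] {y : N} (hy : y ∈ e.baseSet) (c : ℝ) (v : TangentSpace J y) :
    (e (⟨y, c • v⟩ : TangentBundle J N)).2 = c • (e ⟨y, v⟩).2 :=
  (e.linear ℝ hy).map_smul c v

theorem SmoothAlongAt.add (hσ : SmoothAlongAt I J F σ q) (hτ : SmoothAlongAt I J F τ q) :
    SmoothAlongAt I J F (fun p => σ p + τ p) q := by
  rw [smoothAlongAt_iff] at hσ hτ ⊢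
  refine ⟨hσ.1, (hσ.2.add hτ.2).congr_of_eventuallyEq ?_⟩
  filter_upwards [eventually_mem_baseSet_of_continuousAt (J := J) hσ.1.continuousAt] with p hp
  exact triv_add hp _ _

theorem SmoothAlongAt.smul (hc : ContMDiffAt I 𝓘(ℝ, ℝ) ∞ c q) (hσ : SmoothAlongAt I J F σ q) :
    SmoothAlongAt I J F (fun p => c p • σ p) q := by
  rw [smoothAlongAt_iff] at hσ ⊢
  refine ⟨hσ.1, (hc.smul hσ.2).congr_of_eventuallyEq ?_⟩
  filter_upwards [eventually_mem_baseSet_of_continuousAt (J := J) hσ.1.continuousAt] with p hp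
  exact triv_smul hp _ _

theorem MDiffAlongAt.add (hσ : MDiffAlongAt I J F σ q) (hτ : MDiffAlongAt I J F τ q) :
    MDiffAlongAt I J F (fun p => σ p + τ p) q := by
  rw [mdiffAlongAt_iff] at hσ hτ ⊢
  refine ⟨hσ.1, (hσ.2.add hτ.2).congr_of_eventuallyEq ?_⟩
  filter_upwards [eventually_mem_baseSet_of_continuousAt (J := J) hσ.1.continuousAt] with p hp
  exact triv_add hp _ _

theorem MDiffAlongAt.smul (hc : MDifferentiableAt I 𝓘(ℝ, ℝ) c q) (hσ : MDiffAlongAt I J F σ q) :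
    MDiffAlongAt I J F (fun p => c p • σ p) q := by
  rw [mdiffAlongAt_iff] at hσ ⊢
  refine ⟨hσ.1, (hc.smul hσ.2).congr_of_eventuallyEq ?_⟩
  filter_upwards [eventually_mem_baseSet_of_continuousAt (J := J) hσ.1.continuousAt] with p hp
  exact triv_smul hp _ _

theorem SmoothAlongAt.sub (hσ : SmoothAlongAt I J F σ q) (hτ : SmoothAlongAt I J F τ q) :
    SmoothAlongAt I J F (fun p => σ p - τ p) q := by
  have := hσ.add (hτ.smul (contMDiffAt_const (c := (-1 : ℝ))))
  simpa [sub_eq_add_neg] using this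

theorem MDiffAlongAt.sub (hσ : MDiffAlongAt I J F σ q) (hτ : MDiffAlongAt I J F τ q) :
    MDiffAlongAt I J F (fun p => σ p - τ p) q := by
  have := hσ.add (hτ.smul (mdifferentiableAt_const (c := (-1 : ℝ))))
  simpa [sub_eq_add_neg] using this

theorem smoothAlongAt_zero (hF : ContMDiffAt I J ∞ F q) :
    SmoothAlongAt I J F (fun _ => 0) q :=
  ContMDiffAt.comp q (contMDiffAt_zeroSection (IB := J) (F := E') (n := ∞) ℝ (TangentSpace J)) hF

theorem SmoothAlongAt.sum {ι : Type*} (s : Finset ι) {σ : ι → Π q : M, TangentSpace J (F q)}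
    (hF : ContMDiffAt I J ∞ F q) (hσ : ∀ i ∈ s, SmoothAlongAt I J F (σ i) q) :
    SmoothAlongAt I J F (fun p => ∑ i ∈ s, σ i p) q := by
  classical
  induction s using Finset.induction_on with
  | empty => simpa using smoothAlongAt_zero hF
  | insert i s hi ih =>
    simp only [Finset.sum_insert hi]
    exact (hσ i (by simp)).add (ih fun j hj => hσ j (by simp [hj]))

theorem SmoothAlongAt.congr (hσ : SmoothAlongAt I J F σ q) (h : ∀ᶠ p in 𝓝 q, τ p = σ p) :
    SmoothAlongAt I J F τ q :=
  ContMDiffAt.congr_of_eventuallyEq hσ (h.mono fun p hp => by simp [hp])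

theorem MDiffAlongAt.comp {V : Π y : N, TangentSpace J y}
    (hV : MDiffAlongAt J J (fun y => y) V (F q)) (hF : MDifferentiableAt I J F q) :
    MDiffAlongAt I J F (fun p => V (F p)) q :=
  MDifferentiableAt.comp q hV hF

theorem SmoothAlongAt.contMDiffAt (hσ : SmoothAlongAt I J F σ q) : ContMDiffAt I J ∞ F q :=
  (smoothAlongAt_iff.1 hσ).1

theorem MDiffAlongAt.mdifferentiableAt (hσ : MDiffAlongAt I J F σ q) : MDifferentiableAt I J F q :=
  (mdiffAlongAt_iff.1 hσ).1

section Inner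
variable [RiemannianBundle (fun y : N => TangentSpace J y)]
  [IsContMDiffRiemannianBundle J ∞ E' (fun y : N => TangentSpace J y)]

theorem SmoothAlongAt.inner (hσ : SmoothAlongAt I J F σ q) (hτ : SmoothAlongAt I J F τ q) :
    ContMDiffAt I 𝓘(ℝ, ℝ) ∞ (fun p => inner ℝ (σ p) (τ p)) q :=
  ContMDiffAt.inner_bundle (IB := J) (F := E') (E := fun y : N => TangentSpace J y) (b := F) hσ hτ

theorem MDiffAlongAt.inner (hσ : MDiffAlongAt I J F σ q) (hτ : MDiffAlongAt I J F τ q) :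
    MDifferentiableAt I 𝓘(ℝ, ℝ) (fun p => inner ℝ (σ p) (τ p)) q :=
  MDifferentiableAt.inner_bundle (IB := J) (F := E') (E := fun y : N => TangentSpace J y) (b := F)
    hσ hτ

end Inner

theorem SmoothAlongAt.clm_apply {P : Π y : N, TangentSpace J y →L[ℝ] TangentSpace J y}
    (hP : ContMDiff J (J.prod 𝓘(ℝ, E' →L[ℝ] E')) ∞
    (fun y => TotalSpace.mk' (E' →L[ℝ] E')
      (E := fun y : N => TangentSpace J y →L[ℝ] TangentSpace J y) y (P y)))
    (hσ : SmoothAlongAt I J F σ q) : SmoothAlongAt I J F (fun p => P (F p) (σ p)) q :=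
  ContMDiffAt.clm_bundle_apply (F₁ := E') (F₂ := E') (E₁ := fun y : N => TangentSpace J y)
    (E₂ := fun y : N => TangentSpace J y) (b := F)
    (ContMDiffAt.comp q (hP.contMDiffAt (x := F q)) hσ.contMDiffAt) hσ

theorem MDiffAlongAt.clm_apply {P : Π y : N, TangentSpace J y →L[ℝ] TangentSpace J y}
    (hP : ContMDiff J (J.prod 𝓘(ℝ, E' →L[ℝ] E')) ∞
    (fun y => TotalSpace.mk' (E' →L[ℝ] E')
      (E := fun y : N => TangentSpace J y →L[ℝ] TangentSpace J y) y (P y)))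
    (hσ : MDiffAlongAt I J F σ q) : MDiffAlongAt I J F (fun p => P (F p) (σ p)) q :=
  MDifferentiableAt.clm_bundle_apply (F₁ := E') (F₂ := E') (E₁ := fun y : N => TangentSpace J y)
    (E₂ := fun y : N => TangentSpace J y) (b := F)
    (MDifferentiableAt.comp q ((hP.contMDiffAt (x := F q)).mdifferentiableAt (by simp))
      hσ.mdifferentiableAt) hσ

end Along

section Deriv
variable {E : Type*} [NormedAddCommGroup E] [NormedSpace ℝ E]
  {H : Type*} [TopologicalSpace H] {I : ModelWithCorners ℝ E H}
  {M : Type*} [TopologicalSpace M] [ChartedSpace H M] [IsManifold I ∞ M]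
  {E' : Type*} [NormedAddCommGroup E'] [NormedSpace ℝ E']
  {H' : Type*} [TopologicalSpace H'] {J : ModelWithCorners ℝ E' H'}
  {N : Type*} [TopologicalSpace N] [ChartedSpace H' N] [IsManifold J ∞ N]
  {F : M → N} {q : M} {X Y : Π q : M, TangentSpace I q}

theorem smoothAlongAt_mfderiv {s : Set M} (hs : IsOpen s) (hq : q ∈ s)
    (hF : ContMDiffOn I J ∞ F s) (hX : SmoothAlongAt I I (fun q => q) X q) :
    SmoothAlongAt I J F (fun p => mfderiv I J F p (X p)) q := by
  have h1 := (hF.contMDiffOn_tangentMapWithin (m := ∞) (by simp) hs.uniqueMDiffOn).contMDiffAt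
    (x := (⟨q, X q⟩ : TangentBundle I M))
    ((hs.preimage (FiberBundle.continuous_proj E (TangentSpace I))).mem_nhds hq)
  refine (ContMDiffAt.comp q h1 hX).congr_of_eventuallyEq ?_
  filter_upwards [hs.mem_nhds hq] with p hp
  simp [tangentMapWithin, mfderivWithin_of_isOpen hs hp]

theorem contMDiffAt_mvfderiv {s : Set M} (hs : IsOpen s) (hq : q ∈ s) {g : M → ℝ}
    (hg : ContMDiffOn I 𝓘(ℝ, ℝ) ∞ g s) (hX : SmoothAlongAt I I (fun q => q) X q) :
    ContMDiffAt I 𝓘(ℝ, ℝ) ∞ (fun p => mvfderiv I g p (X p)) q :=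
  ContMDiffAt.comp q (contMDiff_snd_tangentBundle_modelSpace ℝ 𝓘(ℝ, ℝ)).contMDiffAt
    (smoothAlongAt_mfderiv hs hq hg hX)

theorem smoothAlongAt_mlieBracket [CompleteSpace E] (hX : SmoothAlongAt I I (fun q => q) X q)
    (hY : SmoothAlongAt I I (fun q => q) Y q) :
    SmoothAlongAt I I (fun q => q) (VectorField.mlieBracket I X Y) q := by
  have : IsManifold I (minSmoothness ℝ 2) M := by
    rw [minSmoothness_of_isRCLikeNormedField]; infer_instance
  have : IsManifold I ((⊤ : ℕ∞) + 1) M := inferInstanceAs (IsManifold I ∞ M)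
  exact ContMDiffAt.mlieBracket_vectorField (m := ⊤) (n := ⊤) hX hY
    (by rw [minSmoothness_of_isRCLikeNormedField]; simp)

theorem exists_smooth_extend (v : TangentSpace I q) :
    ∃ t : Set M, IsOpen t ∧ q ∈ t ∧ ∃ V : Π p : M, TangentSpace I p, V q = v ∧
      ∀ p ∈ t, SmoothAlongAt I I (fun q => q) V p := by
  obtain ⟨s, hs, h⟩ := FiberBundle.exists_contMDiffOn_extend (k := ∞) I E v
  obtain ⟨t, hts, ht, hq⟩ := mem_nhds_iff.1 hs
  exact ⟨t, ht, hq, FiberBundle.extend E v, by simp, fun p hp =>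
    h.contMDiffAt (Filter.mem_of_superset (ht.mem_nhds hp) hts)⟩

theorem SmoothAlongAt.mdifferentiableAt_section (hX : SmoothAlongAt I I (fun q => q) X q) :
    MDifferentiableAt I I.tangent (fun p => (⟨p, X p⟩ : TangentBundle I M)) q :=
  ContMDiffAt.mdifferentiableAt hX (by simp)

/-- `X (Y g) - Y (X g) = [X, Y] g`, deduced from the Jacobi identity. -/
theorem mvfderiv_mvfderiv_sub [FiniteDimensional ℝ E] {s : Set M} (hs : IsOpen s) (hq : q ∈ s)
    {g : M → ℝ} (hg : ContMDiffOn I 𝓘(ℝ, ℝ) ∞ g s)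
    (hX : ∀ p ∈ s, SmoothAlongAt I I (fun q => q) X p)
    (hY : ∀ p ∈ s, SmoothAlongAt I I (fun q => q) Y p) :
    mvfderiv I (fun p => mvfderiv I g p (Y p)) q (X q)
      - mvfderiv I (fun p => mvfderiv I g p (X p)) q (Y q)
      = mvfderiv I g q (VectorField.mlieBracket I X Y q) := by
  have := FiniteDimensional.complete ℝ E
  have : IsManifold I (minSmoothness ℝ 3) M := by
    rw [minSmoothness_of_isRCLikeNormedField]; infer_instance
  rcases subsingleton_or_nontrivial E with hE | hE
  · have h0 : ∀ v : TangentSpace I q, v = 0 := fun v => Subsingleton.elim (α := E) v 0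
    rw [h0 (X q), h0 (Y q), h0 (VectorField.mlieBracket I X Y q)]
    simp
  obtain ⟨w, hw⟩ := exists_ne (0 : E)
  obtain ⟨t, ht, htq, W, hWq, hW⟩ := exists_smooth_extend (I := I) (q := q) w
  have hWq0 : W q ≠ 0 := by rw [hWq]; exact hw
  have hu : ∀ᶠ p in 𝓝 q, p ∈ s ∩ t := (hs.inter ht).mem_nhds ⟨hq, htq⟩
  have hgp : ∀ p ∈ s, ContMDiffAt I 𝓘(ℝ, ℝ) ∞ g p := fun p hp =>
    hg.contMDiffAt (hs.mem_nhds hp)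
  have hgd : ∀ p ∈ s, MDifferentiableAt I 𝓘(ℝ, ℝ) g p := fun p hp =>
    (hgp p hp).mdifferentiableAt (by simp)
  have key : ∀ Y : Π q : M, TangentSpace I q, (∀ p ∈ s, SmoothAlongAt I I (fun q => q) Y p) →
      ∀ X : Π q : M, TangentSpace I q,
      VectorField.mlieBracket I X (VectorField.mlieBracket I Y (g • W)) q
      = (mvfderiv I (fun p => mvfderiv I g p (Y p)) q (X q) • W q
        + mvfderiv I g q (Y q) • VectorField.mlieBracket I X W q)
        + (mvfderiv I g q (X q) • VectorField.mlieBracket I Y W q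
        + g q • VectorField.mlieBracket I X (VectorField.mlieBracket I Y W) q) := by
    intro Y hY X
    have e : VectorField.mlieBracket I Y (g • W) =ᶠ[𝓝 q]
        (fun p => mvfderiv I g p (Y p)) • W + g • VectorField.mlieBracket I Y W := by
      filter_upwards [hu] with p hp
      rw [VectorField.mlieBracket_smul_right (hgd p hp.1) (hW p hp.2).mdifferentiableAt_section]
      rfl
    have hg' : ContMDiffAt I 𝓘(ℝ, ℝ) ∞ (fun p => mvfderiv I g p (Y p)) q :=
      contMDiffAt_mvfderiv hs hq hg (hY q hq)
    have hb := smoothAlongAt_mlieBracket (hY q hq) (hW q htq)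
    have h1 : SmoothAlongAt I I (fun q => q) ((fun p => mvfderiv I g p (Y p)) • W) q :=
      (hW q htq).smul hg'
    have h2 : SmoothAlongAt I I (fun q => q) (g • VectorField.mlieBracket I Y W) q :=
      hb.smul (hgp q hq)
    rw [Filter.EventuallyEq.mlieBracket_vectorField_eq (Filter.EventuallyEq.refl _ X) e,
      VectorField.mlieBracket_add_right h1.mdifferentiableAt_section h2.mdifferentiableAt_section,
      VectorField.mlieBracket_smul_right (hg'.mdifferentiableAt (by simp))
        (hW q htq).mdifferentiableAt_section,
      VectorField.mlieBracket_smul_right (hgd q hq) hb.mdifferentiableAt_section]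
  have hle : minSmoothness ℝ 2 ≤ ∞ := by
    rw [minSmoothness_of_isRCLikeNormedField]; exact ENat.LEInfty.out
  have hgW : SmoothAlongAt I I (fun q => q) (g • W) q := (hW q htq).smul (hgp q hq)
  have j1 := VectorField.leibniz_identity_mlieBracket_apply (ContMDiffAt.of_le (hX q hq) hle)
    (ContMDiffAt.of_le (hY q hq) hle) (ContMDiffAt.of_le hgW hle)
  have j2 := VectorField.leibniz_identity_mlieBracket_apply (ContMDiffAt.of_le (hX q hq) hle)
    (ContMDiffAt.of_le (hY q hq) hle) (ContMDiffAt.of_le (hW q htq) hle)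
  rw [key Y hY X, key X hX Y, j2, VectorField.mlieBracket_smul_right (hgd q hq)
    (hW q htq).mdifferentiableAt_section] at j1
  have : (mvfderiv I (fun p => mvfderiv I g p (Y p)) q (X q)
      - mvfderiv I (fun p => mvfderiv I g p (X p)) q (Y q)
      - mvfderiv I g q (VectorField.mlieBracket I X Y q)) • W q = 0 := by
    rw [← sub_eq_zero] at j1
    rw [← j1]
    module
  rcases smul_eq_zero.1 this with h | h
  · linarith
  · exact absurd h hWq0

end Deriv

section Vfderiv
variable {E : Type*} [NormedAddCommGroup E] [NormedSpace ℝ E]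
  {H : Type*} [TopologicalSpace H] {I : ModelWithCorners ℝ E H}
  {M : Type*} [TopologicalSpace M] [ChartedSpace H M] {q : M}

theorem mvfderiv_congr {f g : M → ℝ} (h : f =ᶠ[𝓝 q] g) (v : TangentSpace I q) :
    mvfderiv I f q v = mvfderiv I g q v := by
  simp only [mvfderiv, ContinuousLinearMap.comp_apply]
  rw [h.mfderiv_eq]
  rfl

theorem mvfderiv_finset_sum {ι : Type*} (s : Finset ι) {f : ι → M → ℝ}
    (hf : ∀ i ∈ s, MDifferentiableAt I 𝓘(ℝ, ℝ) (f i) q) (v : TangentSpace I q) :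
    MDifferentiableAt I 𝓘(ℝ, ℝ) (fun p => ∑ i ∈ s, f i p) q ∧
    mvfderiv I (fun p => ∑ i ∈ s, f i p) q v = ∑ i ∈ s, mvfderiv I (f i) q v := by
  classical
  induction s using Finset.induction_on with
  | empty =>
    simp only [Finset.sum_empty]
    exact ⟨mdifferentiableAt_const, by rw [mvfderiv_const]; rfl⟩
  | insert i s hi ih =>
    obtain ⟨h1, h2⟩ := ih fun j hj => hf j (by simp [hj])
    have e : (fun p => ∑ j ∈ insert i s, f j p) = f i + fun p => ∑ j ∈ s, f j p := by
      ext p; simp [Finset.sum_insert hi]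
    rw [e, mvfderiv_add (hf i (by simp)) h1, Finset.sum_insert hi, ← h2]
    exact ⟨(hf i (by simp)).add h1, rfl⟩

theorem mvfderiv_mul_apply {f g : M → ℝ} (hf : MDifferentiableAt I 𝓘(ℝ, ℝ) f q)
    (hg : MDifferentiableAt I 𝓘(ℝ, ℝ) g q) (v : TangentSpace I q) :
    mvfderiv I (fun p => f p * g p) q v = f q * mvfderiv I g q v + mvfderiv I f q v * g q := by
  have := congrArg (fun L => L v) (mvfderiv_mul hf hg)
  refine this.trans ?_
  simp [mul_comm]

end Vfderiv

section LC
variable {E : Type*} [NormedAddCommGroup E] [NormedSpace ℝ E] [FiniteDimensional ℝ E]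
  {H : Type*} [TopologicalSpace H] {I : ModelWithCorners ℝ E H}
  {M : Type*} [TopologicalSpace M] [ChartedSpace H M] [IsManifold I ∞ M]
  [RiemannianBundle (fun x : M => TangentSpace I x)]
  [IsContMDiffRiemannianBundle I ∞ E (fun x : M => TangentSpace I x)]
  {X Y Z : Π x : M, TangentSpace I x} {x : M}

theorem leviCivita_congr (hX : MDiffAlongAt I I (fun x => x) X x)
    (hY : MDiffAlongAt I I (fun x => x) Y x) (h : ∀ᶠ y in 𝓝 x, X y = Y y) :
    leviCivita I M X x = leviCivita I M Y x :=
  (leviCivita I M).isCovariantDerivativeOnUniv.congr_of_eventuallyEq hX hY Filter.univ_mem h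

theorem leviCivita_add (hX : MDiffAlongAt I I (fun x => x) X x)
    (hY : MDiffAlongAt I I (fun x => x) Y x) :
    leviCivita I M (fun y => X y + Y y) x = leviCivita I M X x + leviCivita I M Y x :=
  (leviCivita I M).isCovariantDerivativeOnUniv.add hX hY

theorem leviCivita_smul {c : M → ℝ} (hc : MDifferentiableAt I 𝓘(ℝ, ℝ) c x)
    (hX : MDiffAlongAt I I (fun x => x) X x) (v : TangentSpace I x) :
    leviCivita I M (fun y => c y • X y) x v
      = mvfderiv I c x v • X x + c x • leviCivita I M X x v := by
  have := congrArg (fun L => L v)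
    ((leviCivita I M).isCovariantDerivativeOnUniv.leibniz (g := c) hX hc)
  refine this.trans ?_
  simp [add_comm]

theorem leviCivita_sum_smul {ι : Type*} (s : Finset ι) {c : ι → M → ℝ}
    {V : ι → Π x : M, TangentSpace I x} (hc : ∀ i ∈ s, MDifferentiableAt I 𝓘(ℝ, ℝ) (c i) x)
    (hV : ∀ i ∈ s, MDiffAlongAt I I (fun x => x) (V i) x) (v : TangentSpace I x) :
    MDiffAlongAt I I (fun x => x) (fun y => ∑ i ∈ s, c i y • V i y) x ∧
    leviCivita I M (fun y => ∑ i ∈ s, c i y • V i y) x v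
      = ∑ i ∈ s, (mvfderiv I (c i) x v • V i x + c i x • leviCivita I M (V i) x v) := by
  classical
  induction s using Finset.induction_on with
  | empty =>
    have h0 := (leviCivita I M).isCovariantDerivativeOnUniv.zero (x := x)
    simp only [Finset.sum_empty]
    exact ⟨(smoothAlongAt_zero (I := I) (J := I) (q := x) contMDiffAt_id).mdiffAlongAt,
      congrArg (fun L => L v) h0⟩
  | insert i s hi ih =>
    obtain ⟨h1, h2⟩ := ih (fun j hj => hc j (by simp [hj])) fun j hj => hV j (by simp [hj])
    have hi' := (hV i (by simp)).smul (hc i (by simp))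
    simp only [Finset.sum_insert hi]
    refine ⟨hi'.add h1, ?_⟩
    rw [leviCivita_add hi' h1, ← h2, ← leviCivita_smul (hc i (by simp)) (hV i (by simp))]
    rfl

theorem leviCivita_sub_eq_mlieBracket (hX : MDiffAlongAt I I (fun x => x) X x)
    (hY : MDiffAlongAt I I (fun x => x) Y x) :
    leviCivita I M Y x (X x) - leviCivita I M X x (Y x) = VectorField.mlieBracket I X Y x := by
  have := FiniteDimensional.complete ℝ E
  exact (CovariantDerivative.torsion_eq_zero_iff _).1 (isLeviCivita_leviCivita (I := I) (M := M)).1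
    hX hY

theorem mvfderiv_inner (hX : MDiffAlongAt I I (fun x => x) X x)
    (hY : MDiffAlongAt I I (fun x => x) Y x) (v : TangentSpace I x) :
    mvfderiv I (fun y => inner ℝ (X y) (Y y)) x v
      = inner ℝ (leviCivita I M X x v) (Y x) + inner ℝ (X x) (leviCivita I M Y x v) := by
  have := FiniteDimensional.complete ℝ E
  have h := (CovariantDerivative.isMetricCompatible_iff _).1
    (isLeviCivita_leviCivita (I := I) (M := M)).2
    (FiberBundle.mdifferentiableAt_extend (I := I) (F := E) v) hX hY
  simpa using h

end LC

section Pullback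
variable {E : Type*} [NormedAddCommGroup E] [NormedSpace ℝ E]
  {H : Type*} [TopologicalSpace H] {I : ModelWithCorners ℝ E H}
  {M : Type*} [TopologicalSpace M] [ChartedSpace H M]
  {E' : Type*} [NormedAddCommGroup E'] [NormedSpace ℝ E'] [FiniteDimensional ℝ E']
  {H' : Type*} [TopologicalSpace H'] {J : ModelWithCorners ℝ E' H'}
  {N : Type*} [TopologicalSpace N] [ChartedSpace H' N] [IsManifold J ∞ N]
  [RiemannianBundle (fun y : N => TangentSpace J y)]
  [IsContMDiffRiemannianBundle J ∞ E' (fun y : N => TangentSpace J y)]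
  {F : M → N} {q : M} {σ τ : Π q : M, TangentSpace J (F q)}

omit [FiniteDimensional ℝ E'] [RiemannianBundle (fun y : N => TangentSpace J y)]
  [IsContMDiffRiemannianBundle J ∞ E' (fun y : N => TangentSpace J y)] in
theorem eq_sum_smul_localFrame {e : Trivialization E' (TotalSpace.proj : TangentBundle J N → N)}
    [MemTrivializationAtlas e] {ι : Type*} [Fintype ι] (b : Module.Basis ι ℝ E') {y : N}
    (hy : y ∈ e.baseSet) (v : TangentSpace J y) :
    v = ∑ i, b.repr (e (⟨y, v⟩ : TangentBundle J N)).2 i • e.localFrame b i y := by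
  classical
  have h1 := e.eq_sum_localFrameCoeff_smul (I := J) (b := b)
    (s := fun z => Function.update (fun _ => 0) y v z) hy
  simp only [Function.update_self] at h1
  refine h1.trans (Finset.sum_congr rfl fun i _ => ?_)
  congr 1
  have := e.localFrameCoeff_eq_coeff (I := J) (b := b) (i := i)
    (s := fun z => Function.update (fun _ => 0) y v z) hy
  simpa using this

/-- The pullback connection may be computed in any family of vector fields on `N`. -/
theorem pullbackCov_eq_sum {ι : Type*} [Fintype ι] {s : ι → Π y : N, TangentSpace J y}
    {c : ι → M → ℝ} (hF : MDifferentiableAt I J F q)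
    (hs : ∀ i, MDiffAlongAt J J (fun y => y) (s i) (F q))
    (hc : ∀ i, MDifferentiableAt I 𝓘(ℝ, ℝ) (c i) q)
    (hσ : ∀ᶠ p in 𝓝 q, σ p = ∑ i, c i p • s i (F p)) (v : TangentSpace I q) :
    pullbackCov I J F σ q v = ∑ i, (mvfderiv I (c i) q v • s i (F q)
      + c i q • leviCivita J N (s i) (F q) (mfderiv I J F q v)) := by
  set e := trivializationAt E' (fun y : N => TangentSpace J y) (F q) with he
  set b := Module.finBasis ℝ E'
  have hq : F q ∈ e.baseSet := mem_baseSet_trivializationAt ..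
  let a : ι → Fin (Module.finrank ℝ E') → N → ℝ := fun i k y => e.localFrameCoeff J b k y (s i y)
  have ha : ∀ i k, MDifferentiableAt J 𝓘(ℝ, ℝ) (a i k) (F q) := fun i k =>
    mdifferentiableAt_localFrameCoeff b hq (hs i) k
  have hfr : ∀ k, MDiffAlongAt J J (fun y => y) (e.localFrame b k) (F q) := fun k =>
    (contMDiffAt_localFrame_of_mem (I := J) (n := ∞) e b k hq).mdifferentiableAt (by simp)
  have hcoe : ∀ k, (fun p => e.localFrameCoeff J b k (F p) (σ p)) =ᶠ[𝓝 q]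
      fun p => ∑ i, c i p * a i k (F p) := by
    intro k
    filter_upwards [hσ] with p hp
    rw [hp]
    simp [a]
  have haF : ∀ i k, MDifferentiableAt I 𝓘(ℝ, ℝ) (fun p => a i k (F p)) q := fun i k =>
    (ha i k).comp q hF
  have hd : ∀ k, mvfderiv I (fun p => e.localFrameCoeff J b k (F p) (σ p)) q v
      = ∑ i, (c i q * mvfderiv J (a i k) (F q) (mfderiv I J F q v)
        + mvfderiv I (c i) q v * a i k (F q)) := by
    intro k
    rw [mvfderiv_congr (hcoe k), (mvfderiv_finset_sum Finset.univ
      (f := fun i p => c i p * a i k (F p)) (fun i _ => (hc i).mul (haF i k)) v).2]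
    refine Finset.sum_congr rfl fun i _ => ?_
    rw [mvfderiv_mul_apply (hc i) (haF i k)]
    congr 2
    exact mvfderiv_comp_apply q (ha i k) hF v
  have hs' : ∀ i, leviCivita J N (s i) (F q) (mfderiv I J F q v)
      = ∑ k, (mvfderiv J (a i k) (F q) (mfderiv I J F q v) • e.localFrame b k (F q)
        + a i k (F q) • leviCivita J N (e.localFrame b k) (F q) (mfderiv I J F q v)) := by
    intro i
    obtain ⟨h1, h2⟩ := leviCivita_sum_smul Finset.univ (c := a i) (V := e.localFrame b)
      (fun k _ => ha i k) (fun k _ => hfr k) (mfderiv I J F q v)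
    rw [← h2, leviCivita_congr (hs i) h1
      (e.eventually_eq_localFrame_sum_coeff_smul b hq)]
  have hsq : ∀ i, s i (F q) = ∑ k, a i k (F q) • e.localFrame b k (F q) := fun i =>
    e.eq_sum_localFrameCoeff_smul hq
  have hcq : ∀ k, e.localFrameCoeff J b k (F q) (σ q) = ∑ i, c i q * a i k (F q) := fun k =>
    (hcoe k).self_of_nhds
  have hdef : pullbackCov I J F σ q v
      = ∑ k, (mvfderiv I (fun p => e.localFrameCoeff J b k (F p) (σ p)) q v • e.localFrame b k (F q)
        + e.localFrameCoeff J b k (F q) (σ q) •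
          leviCivita J N (e.localFrame b k) (F q) (mfderiv I J F q v)) := rfl
  rw [hdef]
  simp only [hd, hcq, hs', hsq]
  simp only [Finset.sum_smul, Finset.smul_sum, ← Finset.sum_add_distrib]
  rw [Finset.sum_comm]
  refine Finset.sum_congr rfl fun i _ => Finset.sum_congr rfl fun k _ => ?_
  module

omit [RiemannianBundle (fun y : N => TangentSpace J y)]
  [IsContMDiffRiemannianBundle J ∞ E' (fun y : N => TangentSpace J y)] in
variable (J F q) in
/-- Differentiable fields along `F` are locally combinations of smooth fields on `N`. -/
theorem exists_frame_along :
    ∃ (s : Fin (Module.finrank ℝ E') → Π y : N, TangentSpace J y) (t : Set N), IsOpen t ∧ F q ∈ t ∧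
      (∀ i, ∀ y ∈ t, SmoothAlongAt J J (fun y => y) (s i) y) ∧
      ∀ σ : Π q : M, TangentSpace J (F q), MDiffAlongAt I J F σ q →
      ∃ c : Fin (Module.finrank ℝ E') → M → ℝ,
        (∀ i, MDifferentiableAt I 𝓘(ℝ, ℝ) (c i) q) ∧
        ∀ᶠ p in 𝓝 q, σ p = ∑ i, c i p • s i (F p) := by
  set e := trivializationAt E' (fun y : N => TangentSpace J y) (F q) with he
  set b := Module.finBasis ℝ E'
  have hq : F q ∈ e.baseSet := mem_baseSet_trivializationAt ..
  refine ⟨e.localFrame b, e.baseSet, e.open_baseSet, hq, fun i y hy =>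
    contMDiffAt_localFrame_of_mem (I := J) (n := ∞) e b i hy, fun σ hσ => ⟨
    fun i p => b.repr (e (⟨F p, σ p⟩ : TangentBundle J N)).2 i, fun i => ?_, ?_⟩⟩
  · exact ((b.coord i).toContinuousLinearMap.mdifferentiableAt).comp q (mdiffAlongAt_iff.1 hσ).2
  · filter_upwards [eventually_mem_baseSet_of_continuousAt (J := J)
      hσ.mdifferentiableAt.continuousAt] with p hp
    exact eq_sum_smul_localFrame b hp (σ p)

end Pullback

section Cutoff
variable {E : Type*} [NormedAddCommGroup E] [NormedSpace ℝ E] [FiniteDimensional ℝ E]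
  {H : Type*} [TopologicalSpace H] {I : ModelWithCorners ℝ E H}
  {M : Type*} [TopologicalSpace M] [T2Space M] [ChartedSpace H M] [IsManifold I ∞ M]
  {E' : Type*} [NormedAddCommGroup E'] [NormedSpace ℝ E']
  {H' : Type*} [TopologicalSpace H'] {J : ModelWithCorners ℝ E' H'}
  {N : Type*} [TopologicalSpace N] [ChartedSpace H' N] [IsManifold J ∞ N]
  {F : M → N} {q : M}

/-- A locally defined smooth field along `F` becomes global after multiplication by a cutoff. -/
theorem exists_cutoff (hF : ContMDiff I J ∞ F) {t : Set M} (ht : t ∈ 𝓝 q) :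
    ∃ ψ : M → ℝ, (∀ᶠ p in 𝓝 q, ψ p = 1) ∧ (∀ p, p ∉ t → ψ p = 0) ∧
      ∀ σ : Π q : M, TangentSpace J (F q), (∀ p ∈ t, SmoothAlongAt I J F σ p) →
        ∀ p, SmoothAlongAt I J F (fun p => ψ p • σ p) p := by
  obtain ⟨ψ, -, hψ⟩ := (SmoothBumpFunction.nhds_basis_tsupport (I := I) q).mem_iff.1 ht
  refine ⟨ψ, ψ.eventuallyEq_one, fun p hp => ?_, fun σ hσ p => ?_⟩
  · by_contra h
    exact hp (hψ (subset_tsupport _ h))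
  · by_cases hp : p ∈ tsupport ψ
    · exact (hσ p (hψ hp)).smul ψ.contMDiff.contMDiffAt
    · refine (smoothAlongAt_zero (hF p)).congr ?_
      filter_upwards [(isClosed_tsupport ψ).isOpen_compl.mem_nhds hp] with p' hp'
      rw [image_eq_zero_of_notMem_tsupport hp', zero_smul]

end Cutoff

section Pullback
variable {E : Type*} [NormedAddCommGroup E] [NormedSpace ℝ E]
  {H : Type*} [TopologicalSpace H] {I : ModelWithCorners ℝ E H}
  {M : Type*} [TopologicalSpace M] [ChartedSpace H M]
  {E' : Type*} [NormedAddCommGroup E'] [NormedSpace ℝ E'] [FiniteDimensional ℝ E']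
  {H' : Type*} [TopologicalSpace H'] {J : ModelWithCorners ℝ E' H'}
  {N : Type*} [TopologicalSpace N] [ChartedSpace H' N] [IsManifold J ∞ N]
  [RiemannianBundle (fun y : N => TangentSpace J y)]
  [IsContMDiffRiemannianBundle J ∞ E' (fun y : N => TangentSpace J y)]
  {F : M → N} {q : M} {σ τ : Π q : M, TangentSpace J (F q)}

theorem pullbackCov_comp (hF : MDifferentiableAt I J F q) {V : Π y : N, TangentSpace J y}
    (hV : MDiffAlongAt J J (fun y => y) V (F q)) (v : TangentSpace I q) :
    pullbackCov I J F (fun p => V (F p)) q v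
      = leviCivita J N V (F q) (mfderiv I J F q v) := by
  rw [pullbackCov_eq_sum (ι := Unit) (s := fun _ => V) (c := fun _ _ => 1) hF (fun _ => hV)
    (fun _ => mdifferentiableAt_const) (Filter.Eventually.of_forall fun p => by simp)]
  simp [mvfderiv_const]

theorem pullbackCov_congr (hσ : MDiffAlongAt I J F σ q) (h : ∀ᶠ p in 𝓝 q, τ p = σ p) :
    pullbackCov I J F τ q = pullbackCov I J F σ q := by
  obtain ⟨s, t, ht, hqt, hs, hc⟩ := exists_frame_along (I := I) J F q
  obtain ⟨c, hc, e⟩ := hc σ hσ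
  ext v
  rw [pullbackCov_eq_sum hσ.mdifferentiableAt (fun i => (hs i _ hqt).mdiffAlongAt) hc e,
    pullbackCov_eq_sum hσ.mdifferentiableAt (fun i => (hs i _ hqt).mdiffAlongAt) hc
      (h.mp (e.mono fun p hp h => h.trans hp))]

theorem pullbackCov_add (hσ : MDiffAlongAt I J F σ q) (hτ : MDiffAlongAt I J F τ q)
    (v : TangentSpace I q) :
    pullbackCov I J F (fun p => σ p + τ p) q v
      = pullbackCov I J F σ q v + pullbackCov I J F τ q v := by
  obtain ⟨s, t, ht, hqt, hs, hc⟩ := exists_frame_along (I := I) J F q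
  obtain ⟨c, hc', e⟩ := hc σ hσ
  obtain ⟨d, hd, e'⟩ := hc τ hτ
  have hs' := fun i => (hs i _ hqt).mdiffAlongAt
  have hadd := pullbackCov_eq_sum (σ := fun p => σ p + τ p) (c := fun i => c i + d i)
    hσ.mdifferentiableAt hs' (fun i => (hc' i).add (hd i)) (by
      filter_upwards [e, e'] with p h h'
      simp [h, h', add_smul, Finset.sum_add_distrib]) v
  rw [hadd, pullbackCov_eq_sum hσ.mdifferentiableAt hs' hc' e,
    pullbackCov_eq_sum hσ.mdifferentiableAt hs' hd e', ← Finset.sum_add_distrib]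
  refine Finset.sum_congr rfl fun i _ => ?_
  rw [mvfderiv_add (hc' i) (hd i)]
  simp only [Pi.add_apply, add_apply]
  module

theorem pullbackCov_smul {a : M → ℝ} (ha : MDifferentiableAt I 𝓘(ℝ, ℝ) a q)
    (hσ : MDiffAlongAt I J F σ q) (v : TangentSpace I q) :
    pullbackCov I J F (fun p => a p • σ p) q v
      = mvfderiv I a q v • σ q + a q • pullbackCov I J F σ q v := by
  obtain ⟨s, t, ht, hqt, hs, hc⟩ := exists_frame_along (I := I) J F q
  obtain ⟨c, hc', e⟩ := hc σ hσ
  have hs' := fun i => (hs i _ hqt).mdiffAlongAt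
  rw [pullbackCov_eq_sum (c := fun i p => a p * c i p)
    hσ.mdifferentiableAt hs' (fun i => ha.mul (hc' i)) (by
      filter_upwards [e] with p h
      simp [h, mul_smul, Finset.smul_sum]) v,
    pullbackCov_eq_sum hσ.mdifferentiableAt hs' hc' e, e.self_of_nhds, Finset.smul_sum,
    Finset.smul_sum, ← Finset.sum_add_distrib]
  refine Finset.sum_congr rfl fun i _ => ?_
  rw [mvfderiv_mul_apply ha (hc' i)]
  module

theorem pullbackCov_sub (hσ : MDiffAlongAt I J F σ q) (hτ : MDiffAlongAt I J F τ q)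
    (v : TangentSpace I q) :
    pullbackCov I J F (fun p => σ p - τ p) q v
      = pullbackCov I J F σ q v - pullbackCov I J F τ q v := by
  have h1 := pullbackCov_smul (mdifferentiableAt_const (c := (-1 : ℝ))) hτ v
  have h2 := pullbackCov_add hσ (hτ.smul (mdifferentiableAt_const (c := (-1 : ℝ)))) v
  rw [h1] at h2
  simpa [sub_eq_add_neg, mvfderiv_const] using h2

theorem inner_sum_sum {V ι κ : Type*} [NormedAddCommGroup V] [InnerProductSpace ℝ V]
    (s : Finset ι) (t : Finset κ) (a : ι → V) (b : κ → V) :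
    inner ℝ (∑ i ∈ s, a i) (∑ j ∈ t, b j) = ∑ i ∈ s, ∑ j ∈ t, inner ℝ (a i) (b j) := by
  rw [sum_inner]
  simp only [inner_sum]

theorem mvfderiv_inner_along (hσ : MDiffAlongAt I J F σ q) (hτ : MDiffAlongAt I J F τ q)
    (v : TangentSpace I q) :
    mvfderiv I (fun p => inner ℝ (σ p) (τ p)) q v
      = inner ℝ (pullbackCov I J F σ q v) (τ q) + inner ℝ (σ q) (pullbackCov I J F τ q v) := by
  obtain ⟨s, t, ht, hqt, hs, hc⟩ := exists_frame_along (I := I) J F q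
  obtain ⟨c, hc', e⟩ := hc σ hσ
  obtain ⟨d, hd, e'⟩ := hc τ hτ
  have hs' := fun i => (hs i _ hqt).mdiffAlongAt
  have hF := hσ.mdifferentiableAt
  have hi : ∀ i j, MDifferentiableAt I 𝓘(ℝ, ℝ) (fun p => inner ℝ (s i (F p)) (s j (F p))) q :=
    fun i j => ((hs' i).inner (hs' j)).comp q hF
  have hi' : ∀ i j, mvfderiv I (fun p => inner ℝ (s i (F p)) (s j (F p))) q v
      = inner ℝ (leviCivita J N (s i) (F q) (mfderiv I J F q v)) (s j (F q))
        + inner ℝ (s i (F q)) (leviCivita J N (s j) (F q) (mfderiv I J F q v)) := by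
    intro i j
    rw [← mvfderiv_inner (hs' i) (hs' j)]
    exact mvfderiv_comp_apply q ((hs' i).inner (hs' j)) hF v
  have e2 : (fun p => inner ℝ (σ p) (τ p)) =ᶠ[𝓝 q]
      fun p => ∑ i, ∑ j, (c i p * d j p) * inner ℝ (s i (F p)) (s j (F p)) := by
    filter_upwards [e, e'] with p h h'
    rw [h, h', inner_sum_sum]
    simp only [real_inner_smul_left, real_inner_smul_right]
    refine Finset.sum_congr rfl fun i _ => Finset.sum_congr rfl fun j _ => ?_
    ring
  have hcd : ∀ i j, MDifferentiableAt I 𝓘(ℝ, ℝ) (fun p => c i p * d j p) q := fun i j =>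
    (hc' i).mul (hd j)
  have hm : ∀ i j, MDifferentiableAt I 𝓘(ℝ, ℝ)
      (fun p => (c i p * d j p) * inner ℝ (s i (F p)) (s j (F p))) q := fun i j =>
    (hcd i j).mul (hi i j)
  rw [mvfderiv_congr e2, (mvfderiv_finset_sum Finset.univ
    (fun i _ => (mvfderiv_finset_sum Finset.univ (fun j _ => hm i j) v).1) v).2,
    pullbackCov_eq_sum hF hs' hc' e, pullbackCov_eq_sum hF hs' hd e', e.self_of_nhds,
    e'.self_of_nhds]
  rw [inner_sum_sum, inner_sum_sum]
  simp only [← Finset.sum_add_distrib]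
  refine Finset.sum_congr rfl fun i _ => ?_
  rw [(mvfderiv_finset_sum Finset.univ (fun j _ => hm i j) v).2]
  refine Finset.sum_congr rfl fun j _ => ?_
  rw [mvfderiv_mul_apply (hcd i j) (hi i j), mvfderiv_mul_apply (hc' i) (hd j), hi']
  simp only [inner_add_left, inner_add_right, real_inner_smul_left, real_inner_smul_right]
  ring

theorem pullbackCov_clm_apply [T2Space N] {P : Π y : N, TangentSpace J y →L[ℝ] TangentSpace J y}
    (hP : IsKahler J P) (hσ : MDiffAlongAt I J F σ q) (v : TangentSpace I q) :
    pullbackCov I J F (fun p => P (F p) (σ p)) q v = P (F q) (pullbackCov I J F σ q v) := by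
  obtain ⟨s, t, ht, hqt, hs, hc⟩ := exists_frame_along (I := I) J F q
  obtain ⟨c, hc', e⟩ := hc σ hσ
  have hs' := fun i => (hs i _ hqt).mdiffAlongAt
  have hF := hσ.mdifferentiableAt
  have hPs : ∀ i, leviCivita J N (fun y => P y (s i y)) (F q) (mfderiv I J F q v)
      = P (F q) (leviCivita J N (s i) (F q) (mfderiv I J F q v)) := by
    intro i
    obtain ⟨ψ, h1, -, h2⟩ := exists_cutoff (I := J) (J := J) (F := fun y : N => y) (q := F q)
      contMDiff_id (ht.mem_nhds hqt)
    have h3 := h2 (s i) (hs i)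
    have h4 := hP.parallel (fun y => ψ y • s i y) (IsSmoothFieldAlongOn.of_smoothAlongAt
      fun y _ => h3 y) (F q) (mfderiv I J F q v)
    rw [leviCivita_congr (h3 (F q)).mdiffAlongAt (hs' i)
      (h1.mono fun y hy => by rw [hy, one_smul])] at h4
    rw [← h4]
    refine congrArg (fun L => L (mfderiv I J F q v)) (leviCivita_congr
      ((hs' i).clm_apply hP.smooth) ((h3 (F q)).mdiffAlongAt.clm_apply hP.smooth)
      (h1.mono fun y hy => by rw [hy, one_smul]))
  rw [pullbackCov_eq_sum hF (fun i => (hs' i).clm_apply hP.smooth) hc'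
    (e.mono fun p hp => by simp [hp]), pullbackCov_eq_sum hF hs' hc' e]
  simp [hPs]

end Pullback

section Symmetry
variable {E : Type*} [NormedAddCommGroup E] [NormedSpace ℝ E] [FiniteDimensional ℝ E]
  {H : Type*} [TopologicalSpace H] {I : ModelWithCorners ℝ E H}
  {M : Type*} [TopologicalSpace M] [ChartedSpace H M] [IsManifold I ∞ M]
  {E' : Type*} [NormedAddCommGroup E'] [NormedSpace ℝ E'] [FiniteDimensional ℝ E']
  {H' : Type*} [TopologicalSpace H'] {J : ModelWithCorners ℝ E' H'}
  {N : Type*} [TopologicalSpace N] [ChartedSpace H' N] [IsManifold J ∞ N]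
  [RiemannianBundle (fun y : N => TangentSpace J y)]
  [IsContMDiffRiemannianBundle J ∞ E' (fun y : N => TangentSpace J y)]
  {F : M → N} {q : M} {X Y : Π q : M, TangentSpace I q}

omit [RiemannianBundle (fun y : N => TangentSpace J y)]
  [IsContMDiffRiemannianBundle J ∞ E' (fun y : N => TangentSpace J y)] in
/-- Smooth local functions separate tangent vectors. -/
theorem eq_zero_of_forall_mvfderiv_eq_zero {y : N} {w : TangentSpace J y}
    (h : ∀ (t : Set N) (g : N → ℝ), IsOpen t → y ∈ t → ContMDiffOn J 𝓘(ℝ, ℝ) ∞ g t →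
      mvfderiv J g y w = 0) : w = 0 := by
  have hinv := isInvertible_mfderiv_extChartAt (I := J) (mem_extChartAt_source (I := J) y)
  have hd : MDifferentiableAt J 𝓘(ℝ, E') (extChartAt J y) y :=
    mdifferentiableAt_extChartAt (mem_chart_source H' y)
  have h0 : mfderiv J 𝓘(ℝ, E') (extChartAt J y) y w = (0 : E') := by
    refine SeparatingDual.eq_zero_of_forall_dual_eq_zero (R := ℝ) (V := E') fun L => ?_
    have h1 := h (chartAt H' y).source (L ∘ extChartAt J y) (chartAt H' y).open_source
      (mem_chart_source H' y)
      (L.contMDiff.comp_contMDiffOn (contMDiffOn_extChartAt (I := J) (n := ∞)))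
    have h2 := mfderiv_comp_apply y (g := L) L.mdifferentiableAt hd w
    rw [ContinuousLinearMap.mfderiv_eq] at h2
    exact h2.symm.trans h1
  obtain ⟨A, hA⟩ := hinv
  have : A w = 0 := by
    have := congrArg (fun L => L w) hA
    exact this.trans h0
  exact A.map_eq_zero_iff.1 this

/-- The differential of a smooth map is symmetric with respect to the pullback of the
Levi-Civita connection. -/
theorem pullbackCov_mfderiv_sub (hF : ContMDiff I J ∞ F)
    {u : Set M} (hu : IsOpen u) (hq : q ∈ u)
    (hX : ∀ p ∈ u, SmoothAlongAt I I (fun p => p) X p)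
    (hY : ∀ p ∈ u, SmoothAlongAt I I (fun p => p) Y p) :
    pullbackCov I J F (fun p => mfderiv I J F p (Y p)) q (X q)
      - pullbackCov I J F (fun p => mfderiv I J F p (X p)) q (Y q)
      = mfderiv I J F q (VectorField.mlieBracket I X Y q) := by
  rw [← sub_eq_zero]
  refine eq_zero_of_forall_mvfderiv_eq_zero fun t₀ g ht₀ hqt₀ hg => ?_
  obtain ⟨s, t₁, ht₁, hqt₁, hs, hc⟩ := exists_frame_along (I := I) J F q
  have hFd : MDifferentiableAt I J F q := (hF q).mdifferentiableAt (by simp)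
  have hs' := fun i => (hs i _ hqt₁).mdiffAlongAt
  let D : Fin (Module.finrank ℝ E') → TangentSpace J (F q) →ₗ[ℝ] ℝ := fun i =>
    ((mvfderiv J (fun y => mvfderiv J g y (s i y)) (F q)).toLinearMap
      - (mvfderiv J g (F q)).toLinearMap ∘ₗ (leviCivita J N (s i) (F q)).toLinearMap)
  have hD : ∀ i j, D i (s j (F q)) = D j (s i (F q)) := by
    intro i j
    have h1 := mvfderiv_mvfderiv_sub (ht₀.inter ht₁) ⟨hqt₀, hqt₁⟩ (hg.mono inter_subset_left)
      (fun p hp => hs j p hp.2) (fun p hp => hs i p hp.2)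
    rw [← leviCivita_sub_eq_mlieBracket (hs' j) (hs' i), map_sub] at h1
    simp only [D, LinearMap.sub_apply, LinearMap.comp_apply, ContinuousLinearMap.coe_coe]
    linarith
  have hgs : ∀ i, MDifferentiableAt J 𝓘(ℝ, ℝ) (fun y => mvfderiv J g y (s i y)) (F q) := fun i =>
    (contMDiffAt_mvfderiv ht₀ hqt₀ hg (hs i _ hqt₁)).mdifferentiableAt (by simp)
  have key : ∀ (σ : Π p : M, TangentSpace J (F p)) (c : Fin (Module.finrank ℝ E') → M → ℝ),
      (∀ i, MDifferentiableAt I 𝓘(ℝ, ℝ) (c i) q) →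
      (∀ᶠ p in 𝓝 q, σ p = ∑ i, c i p • s i (F p)) → ∀ v : TangentSpace I q,
      mvfderiv I (fun p => mvfderiv J g (F p) (σ p)) q v
        = mvfderiv J g (F q) (pullbackCov I J F σ q v)
          + ∑ i, c i q * D i (mfderiv I J F q v) := by
    intro σ c hc e v
    have e2 : (fun p => mvfderiv J g (F p) (σ p)) =ᶠ[𝓝 q]
        fun p => ∑ i, c i p * mvfderiv J g (F p) (s i (F p)) := by
      filter_upwards [e] with p hp
      simp [hp]
    have hm : ∀ i, MDifferentiableAt I 𝓘(ℝ, ℝ) (fun p => mvfderiv J g (F p) (s i (F p))) q :=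
      fun i => (hgs i).comp q hFd
    rw [mvfderiv_congr e2, (mvfderiv_finset_sum Finset.univ
      (f := fun i p => c i p * mvfderiv J g (F p) (s i (F p)))
      (fun i _ => (hc i).mul (hm i)) v).2, pullbackCov_eq_sum hFd hs' hc e, map_sum,
      ← Finset.sum_add_distrib]
    refine Finset.sum_congr rfl fun i _ => ?_
    have h3 : mvfderiv I (fun p => mvfderiv J g (F p) (s i (F p))) q v
        = mvfderiv J (fun y => mvfderiv J g y (s i y)) (F q) (mfderiv I J F q v) :=
      mvfderiv_comp_apply q (hgs i) hFd v
    rw [mvfderiv_mul_apply (hc i) (hm i), h3]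
    simp only [D, map_add, map_smul, LinearMap.sub_apply, LinearMap.comp_apply,
      ContinuousLinearMap.coe_coe, smul_eq_mul]
    ring
  have hFY := smoothAlongAt_mfderiv hu hq hF.contMDiffOn (hY q hq)
  have hFX := smoothAlongAt_mfderiv hu hq hF.contMDiffOn (hX q hq)
  obtain ⟨c, hc', e⟩ := hc _ hFY.mdiffAlongAt
  obtain ⟨d, hd', e'⟩ := hc _ hFX.mdiffAlongAt
  have k1 := key _ c hc' e (X q)
  have k2 := key _ d hd' e' (Y q)
  have hsum : ∑ i, c i q * D i (mfderiv I J F q (X q))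
      = ∑ i, d i q * D i (mfderiv I J F q (Y q)) := by
    rw [e.self_of_nhds, e'.self_of_nhds]
    simp only [map_sum, map_smul, smul_eq_mul, Finset.mul_sum]
    rw [Finset.sum_comm]
    refine Finset.sum_congr rfl fun i _ => Finset.sum_congr rfl fun j _ => ?_
    rw [hD i j]
    ring
  have hgF : ContMDiffOn I 𝓘(ℝ, ℝ) ∞ (g ∘ F) (u ∩ F ⁻¹' t₀) :=
    hg.comp hF.contMDiffOn fun p hp => hp.2
  have hu' : IsOpen (u ∩ F ⁻¹' t₀) := hu.inter (ht₀.preimage hF.continuous)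
  have hcomp : ∀ p ∈ u ∩ F ⁻¹' t₀, ∀ v : TangentSpace I p,
      mvfderiv I (g ∘ F) p v = mvfderiv J g (F p) (mfderiv I J F p v) := fun p hp v =>
    mvfderiv_comp_apply p ((hg.contMDiffAt (ht₀.mem_nhds hp.2)).mdifferentiableAt (by simp))
      ((hF p).mdifferentiableAt (by simp)) v
  have k3 := mvfderiv_mvfderiv_sub hu' ⟨hq, hqt₀⟩ hgF (fun p hp => hX p hp.1)
    (fun p hp => hY p hp.1)
  have ev : ∀ Z : Π p : M, TangentSpace I p, (fun p => mvfderiv I (g ∘ F) p (Z p)) =ᶠ[𝓝 q]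
      fun p => mvfderiv J g (F p) (mfderiv I J F p (Z p)) := fun Z => by
    filter_upwards [hu'.mem_nhds ⟨hq, hqt₀⟩] with p hp
    exact hcomp p hp _
  rw [mvfderiv_congr (ev Y), mvfderiv_congr (ev X), hcomp q ⟨hq, hqt₀⟩, k1, k2, hsum] at k3
  rw [map_sub, map_sub]
  linarith

end Symmetry

theorem starProjection_eq_sum_of_orthonormal {V : Type*} [NormedAddCommGroup V]
    [InnerProductSpace ℝ V] {k : ℕ} {e : Fin k → V} (he : Orthonormal ℝ e) {S : Submodule ℝ V}
    [S.HasOrthogonalProjection] (hS : S = Submodule.span ℝ (range e)) (v : V) :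
    S.starProjection v = ∑ i, inner ℝ (e i) v • e i := by
  refine Submodule.eq_starProjection_of_mem_of_inner_eq_zero ?_ fun w hw => ?_
  · rw [hS]
    exact Submodule.sum_mem _ fun i _ => Submodule.smul_mem _ _ (Submodule.subset_span ⟨i, rfl⟩)
  · rw [hS] at hw
    induction hw using Submodule.span_induction with
    | mem x hx =>
      obtain ⟨j, rfl⟩ := hx
      rw [inner_sub_left, sum_inner]
      simp only [real_inner_smul_left, orthonormal_iff_ite.1 he]
      simp [real_inner_comm]
    | zero => simp
    | add x y _ _ hx hy => rw [inner_add_right, hx, hy, add_zero]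
    | smul a x _ hx => rw [real_inner_smul_right, hx, mul_zero]

section GramSchmidt
variable {E : Type*} [NormedAddCommGroup E] [NormedSpace ℝ E]
  {H : Type*} [TopologicalSpace H] {I : ModelWithCorners ℝ E H}
  {M : Type*} [TopologicalSpace M] [ChartedSpace H M]
  {E' : Type*} [NormedAddCommGroup E'] [NormedSpace ℝ E']
  {H' : Type*} [TopologicalSpace H'] {J : ModelWithCorners ℝ E' H'}
  {N : Type*} [TopologicalSpace N] [ChartedSpace H' N] [IsManifold J ∞ N]
  [RiemannianBundle (fun y : N => TangentSpace J y)]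
  [IsContMDiffRiemannianBundle J ∞ E' (fun y : N => TangentSpace J y)]
  {F : M → N} {q : M}

theorem smoothAlongAt_gramSchmidt {k : ℕ} {σ : Fin k → Π q : M, TangentSpace J (F q)}
    (hF : ContMDiffAt I J ∞ F q) (hσ : ∀ i, SmoothAlongAt I J F (σ i) q)
    (hli : LinearIndependent ℝ fun i => σ i q) (i : Fin k) :
    SmoothAlongAt I J F (fun p => InnerProductSpace.gramSchmidt ℝ (fun i => σ i p) i) q := by
  induction i using WellFoundedLT.induction with
  | ind i ih =>
    have e : (fun p => InnerProductSpace.gramSchmidt ℝ (fun i => σ i p) i) = fun p => σ i p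
        - ∑ j ∈ Finset.Iio i, ((inner ℝ (InnerProductSpace.gramSchmidt ℝ (fun i => σ i p) j) (σ i p)
          * (inner ℝ (InnerProductSpace.gramSchmidt ℝ (fun i => σ i p) j)
            (InnerProductSpace.gramSchmidt ℝ (fun i => σ i p) j))⁻¹) •
          InnerProductSpace.gramSchmidt ℝ (fun i => σ i p) j) := by
      ext p
      rw [eq_sub_iff_add_eq]
      refine Eq.trans ?_ (InnerProductSpace.gramSchmidt_def'' ℝ (fun i => σ i p) i).symm
      simp [div_eq_mul_inv]
    rw [e]
    refine (hσ i).sub (SmoothAlongAt.sum _ hF fun j hj => ?_)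
    have hj' := ih j (Finset.mem_Iio.1 hj)
    refine hj'.smul ((hj'.inner (hσ i)).mul ((hj'.inner hj').inv₀ ?_))
    rw [inner_self_ne_zero]
    exact InnerProductSpace.gramSchmidt_ne_zero j hli

theorem smoothAlongAt_gramSchmidtNormed {k : ℕ} {σ : Fin k → Π q : M, TangentSpace J (F q)}
    (hF : ContMDiffAt I J ∞ F q) (hσ : ∀ i, SmoothAlongAt I J F (σ i) q)
    (hli : LinearIndependent ℝ fun i => σ i q) (i : Fin k) :
    SmoothAlongAt I J F (fun p => InnerProductSpace.gramSchmidtNormed ℝ (fun i => σ i p) i) q := by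
  have h := smoothAlongAt_gramSchmidt hF hσ hli i
  have h0 : inner ℝ (InnerProductSpace.gramSchmidt ℝ (fun i => σ i q) i)
      (InnerProductSpace.gramSchmidt ℝ (fun i => σ i q) i) ≠ 0 := by
    rw [inner_self_ne_zero]
    exact InnerProductSpace.gramSchmidt_ne_zero i hli
  have h1 : ContMDiffAt I 𝓘(ℝ, ℝ) ∞ (fun p =>
      (√(inner ℝ (InnerProductSpace.gramSchmidt ℝ (fun i => σ i p) i)
        (InnerProductSpace.gramSchmidt ℝ (fun i => σ i p) i)))⁻¹) q := by
    refine ContMDiffAt.inv₀ ?_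
      (Real.sqrt_ne_zero'.2 (lt_of_le_of_ne real_inner_self_nonneg h0.symm))
    exact ((Real.contDiffAt_sqrt h0).contMDiffAt).comp q (h.inner h)
  refine (h.smul h1).congr (Filter.Eventually.of_forall fun p => ?_)
  simp [InnerProductSpace.gramSchmidtNormed]

/-- A smooth subbundle has local orthonormal frames. -/
theorem IsSmoothSubbundleOn.exists_orthonormal {S : Π q : M, Submodule ℝ (TangentSpace J (F q))}
    {s : Set M} (hS : IsSmoothSubbundleOn I J F S s) (hq : q ∈ s) :
    ∃ U : Set M, IsOpen U ∧ q ∈ U ∧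
    ∃ (k : ℕ) (e : Fin k → Π q : M, TangentSpace J (F q)),
      (∀ i, ∀ p ∈ U, SmoothAlongAt I J F (e i) p) ∧
      ∀ p ∈ U, Orthonormal ℝ (fun i => e i p) ∧ S p = Submodule.span ℝ (range fun i => e i p) := by
  obtain ⟨U, hU, hqU, k, σ, h1, h2⟩ := hS q hq
  have h1' : ∀ i, ∀ p ∈ U, SmoothAlongAt I J F (σ i) p := fun i p hp =>
    (h1 i).smoothAlongAt (hU.mem_nhds hp)
  rcases Nat.eq_zero_or_pos k with rfl | hk
  · exact ⟨U, hU, hqU, 0, σ, h1', fun p hp => ⟨⟨fun i => i.elim0, fun i => i.elim0⟩, (h2 p hp).2⟩⟩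
  refine ⟨U, hU, hqU, k, fun i p => InnerProductSpace.gramSchmidtNormed ℝ (fun i => σ i p) i,
    fun i p hp => smoothAlongAt_gramSchmidtNormed (h1' ⟨0, hk⟩ p hp).contMDiffAt
      (fun i => h1' i p hp) (h2 p hp).1 i, fun p hp =>
      ⟨InnerProductSpace.gramSchmidtNormed_orthonormal (h2 p hp).1, ?_⟩⟩
  rw [(h2 p hp).2]
  exact (InnerProductSpace.span_gramSchmidt ℝ _).symm.trans
    (InnerProductSpace.span_gramSchmidtNormed_range _).symm

end GramSchmidt

section Smooth
variable {E : Type*} [NormedAddCommGroup E] [NormedSpace ℝ E] [FiniteDimensional ℝ E]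
  {H : Type*} [TopologicalSpace H] {I : ModelWithCorners ℝ E H}
  {M : Type*} [TopologicalSpace M] [ChartedSpace H M] [IsManifold I ∞ M]
  [RiemannianBundle (fun x : M => TangentSpace I x)]
  [IsContMDiffRiemannianBundle I ∞ E (fun x : M => TangentSpace I x)]
  {X Y : Π x : M, TangentSpace I x} {x : M}

omit [RiemannianBundle (fun x : M => TangentSpace I x)]
  [IsContMDiffRiemannianBundle I ∞ E (fun x : M => TangentSpace I x)] in
theorem isSmoothSubbundleOn_top :
    IsSmoothSubbundleOn I I (fun x : M => x) (fun _ => ⊤) univ := by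
  intro x _
  set e := trivializationAt E (fun x : M => TangentSpace I x) x
  set b := Module.finBasis ℝ E
  have h := e.isLocalFrameOn_localFrame_baseSet I ∞ b
  exact ⟨e.baseSet, e.open_baseSet, mem_baseSet_trivializationAt .., _, e.localFrame b,
    h.contMDiffOn, fun y hy => ⟨h.linearIndependent hy, (top_le_iff.1 (h.generating hy)).symm⟩⟩

/-- A vector field is smooth if its inner products with smooth vector fields are smooth. -/
theorem smoothAlongAt_of_inner (h : ∀ (t : Set M) (e : Π x : M, TangentSpace I x), IsOpen t →
    x ∈ t → (∀ y ∈ t, SmoothAlongAt I I (fun x => x) e y) →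
      ContMDiffAt I 𝓘(ℝ, ℝ) ∞ (fun y => inner ℝ (e y) (Y y)) x) :
    SmoothAlongAt I I (fun x => x) Y x := by
  obtain ⟨U, hU, hx, k, e, h1, h2⟩ :=
    (isSmoothSubbundleOn_top (I := I) (M := M)).exists_orthonormal (mem_univ x)
  refine (SmoothAlongAt.sum Finset.univ contMDiffAt_id fun i _ =>
    (h1 i x hx).smul (h U (e i) hU hx (h1 i))).congr ?_
  filter_upwards [hU.mem_nhds hx] with y hy
  rw [← starProjection_eq_sum_of_orthonormal (h2 y hy).1 (h2 y hy).2]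
  exact (Submodule.starProjection_eq_self_iff.2 Submodule.mem_top).symm

theorem smoothAlongAt_leviCivita {u : Set M} (hu : IsOpen u) (hx : x ∈ u)
    (hX : ∀ y ∈ u, SmoothAlongAt I I (fun x => x) X y)
    (hY : ∀ y ∈ u, SmoothAlongAt I I (fun x => x) Y y) :
    SmoothAlongAt I I (fun x => x) (fun y => leviCivita I M Y y (X y)) x := by
  have := FiniteDimensional.complete ℝ E
  refine smoothAlongAt_of_inner fun t e ht hxt he => ?_
  have hv : u ∩ t ∈ 𝓝 x := (hu.inter ht).mem_nhds ⟨hx, hxt⟩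
  have hk : (fun y => inner ℝ (e y) (leviCivita I M Y y (X y))) =ᶠ[𝓝 x]
      fun y => koszul Y X e y / 2 := by
    filter_upwards [hv] with y hy
    rw [real_inner_comm]
    exact inner_koszulCov (hX y hy.1).mdiffAlongAt (hY y hy.1).mdiffAlongAt
      (he y hy.2).mdiffAlongAt
  refine ContMDiffAt.congr_of_eventuallyEq ?_ hk
  have hin : ∀ A B C : Π x : M, TangentSpace I x,
      (∀ y ∈ u ∩ t, SmoothAlongAt I I (fun x => x) A y) →
      (∀ y ∈ u ∩ t, SmoothAlongAt I I (fun x => x) B y) →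
      (∀ y ∈ u ∩ t, SmoothAlongAt I I (fun x => x) C y) →
      ContMDiffAt I 𝓘(ℝ, ℝ) ∞ (fun y => mvfderiv I (fun z => inner ℝ (A z) (B z)) y (C y)) x :=
    fun A B C hA hB hC => contMDiffAt_mvfderiv (hu.inter ht) ⟨hx, hxt⟩
      (fun y hy => ((hA y hy).inner (hB y hy)).contMDiffWithinAt) (hC x ⟨hx, hxt⟩)
  have hX' : ∀ y ∈ u ∩ t, SmoothAlongAt I I (fun x => x) X y := fun y hy => hX y hy.1
  have hY' : ∀ y ∈ u ∩ t, SmoothAlongAt I I (fun x => x) Y y := fun y hy => hY y hy.1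
  have he' : ∀ y ∈ u ∩ t, SmoothAlongAt I I (fun x => x) e y := fun y hy => he y hy.2
  have hm : x ∈ u ∩ t := ⟨hx, hxt⟩
  have := ((((((hin Y e X hY' he' hX').add (hin e X Y he' hX' hY')).sub (hin X Y e hX' hY' he')).add
    ((smoothAlongAt_mlieBracket (hX' x hm) (hY' x hm)).inner (he' x hm))).sub
    ((smoothAlongAt_mlieBracket (hY' x hm) (he' x hm)).inner (hX' x hm))).add
    ((smoothAlongAt_mlieBracket (he' x hm) (hX' x hm)).inner (hY' x hm))).mul
      (contMDiffAt_const (c := (1 / 2 : ℝ)))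
  refine this.congr_of_eventuallyEq (Filter.Eventually.of_forall fun y => ?_)
  simp [koszul, div_eq_mul_inv]

end Smooth

section Adjoint
variable {E : Type*} [NormedAddCommGroup E] [NormedSpace ℝ E] [FiniteDimensional ℝ E]
  {H : Type*} [TopologicalSpace H] {I : ModelWithCorners ℝ E H}
  {M : Type*} [TopologicalSpace M] [ChartedSpace H M] [IsManifold I ∞ M]
  [RiemannianBundle (fun x : M => TangentSpace I x)]
  [IsContMDiffRiemannianBundle I ∞ E (fun x : M => TangentSpace I x)]
  {E' : Type*} [NormedAddCommGroup E'] [NormedSpace ℝ E'] [FiniteDimensional ℝ E']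
  {H' : Type*} [TopologicalSpace H'] {J : ModelWithCorners ℝ E' H'}
  {N : Type*} [TopologicalSpace N] [ChartedSpace H' N] [IsManifold J ∞ N]
  [RiemannianBundle (fun y : N => TangentSpace J y)]
  [IsContMDiffRiemannianBundle J ∞ E' (fun y : N => TangentSpace J y)]
  {F : M → N} {q : M}

variable (I J F) in
/-- The adjoint of `F_*` at `q`. -/
def adjDeriv (q : M) : TangentSpace J (F q) →L[ℝ] TangentSpace I q :=
  ContinuousLinearMap.adjoint (mfderiv I J F q)

theorem inner_adjDeriv (v : TangentSpace I q) (w : TangentSpace J (F q)) :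
    inner ℝ v (adjDeriv I J F q w) = inner ℝ (mfderiv I J F q v) w :=
  ContinuousLinearMap.adjoint_inner_right _ _ _

theorem smoothAlongAt_adjDeriv (hF : ContMDiff I J ∞ F) {σ : Π q : M, TangentSpace J (F q)}
    (hσ : SmoothAlongAt I J F σ q) :
    SmoothAlongAt I I (fun q => q) (fun p => adjDeriv I J F p (σ p)) q := by
  refine smoothAlongAt_of_inner fun t e ht hqt he => ?_
  simp only [inner_adjDeriv]
  exact (smoothAlongAt_mfderiv ht hqt hF.contMDiffOn (he q hqt)).inner hσ

end Adjoint

/-- Local existence for an autonomous second-order differential equation. -/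
theorem exists_second_order_solution {V : Type*} [NormedAddCommGroup V] [NormedSpace ℝ V]
    [CompleteSpace V] {Q : V × V → V} {O : Set V} (hO : IsOpen O)
    (hQ : ContDiffOn ℝ 1 Q (O ×ˢ univ)) {x₀ : V} (hx₀ : x₀ ∈ O) (p₀ : V) :
    ∃ ε > 0, ∃ c p : ℝ → V, c 0 = x₀ ∧ p 0 = p₀ ∧ ContDiffOn ℝ 2 c (Ioo (-ε) ε) ∧
      ∀ t ∈ Ioo (-ε) ε, c t ∈ O ∧ HasDerivAt c (p t) t ∧ HasDerivAt p (Q (c t, p t)) t := by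
  have hO' : IsOpen (O ×ˢ (univ : Set V)) := hO.prod isOpen_univ
  have hΦ : ContDiffAt ℝ 1 (fun z : V × V => (z.2, Q z)) (x₀, p₀) :=
    contDiffAt_snd.prodMk (hQ.contDiffAt (hO'.mem_nhds ⟨hx₀, mem_univ _⟩))
  obtain ⟨r, hr, ε, hε, h⟩ :=
    hΦ.exists_forall_mem_closedBall_exists_eq_forall_mem_Ioo_hasDerivAt 0
  obtain ⟨α, hα0, hα⟩ := h (x₀, p₀) (Metric.mem_closedBall_self hr.le)
  simp only [zero_sub, zero_add] at hα
  have hc0 : ContinuousAt (fun t => (α t).1) 0 :=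
    (hα 0 ⟨by linarith, hε⟩).continuousAt.fst
  have hn : (fun t => (α t).1) ⁻¹' O ∈ 𝓝 0 := hc0 (hO.mem_nhds (by simpa [hα0] using hx₀))
  obtain ⟨δ, hδ, hball⟩ := Metric.mem_nhds_iff.1 hn
  have hsub : ∀ t ∈ Ioo (-(min ε δ)) (min ε δ), t ∈ Ioo (-ε) ε ∧ (α t).1 ∈ O := by
    intro t ht
    refine ⟨⟨by linarith [ht.1, min_le_left ε δ], by linarith [ht.2, min_le_left ε δ]⟩,
      hball ?_⟩
    rw [Metric.mem_ball, Real.dist_eq, sub_zero, abs_lt]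
    exact ⟨by linarith [ht.1, min_le_right ε δ], by linarith [ht.2, min_le_right ε δ]⟩
  have h1 : ∀ t ∈ Ioo (-(min ε δ)) (min ε δ), HasDerivAt (fun t => (α t).1) (α t).2 t :=
    fun t ht => (hα t (hsub t ht).1).fst
  have h2 : ∀ t ∈ Ioo (-(min ε δ)) (min ε δ), HasDerivAt (fun t => (α t).2) (Q (α t)) t :=
    fun t ht => (hα t (hsub t ht).1).snd
  refine ⟨min ε δ, lt_min hε hδ, fun t => (α t).1, fun t => (α t).2, by simp [hα0],
    by simp [hα0], ?_, fun t ht => ⟨(hsub t ht).2, h1 t ht, h2 t ht⟩⟩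
  have hαc : ContinuousOn α (Ioo (-(min ε δ)) (min ε δ)) := fun t ht =>
    (hα t (hsub t ht).1).continuousAt.continuousWithinAt
  have hp : ContDiffOn ℝ (0 + 1) (fun t => (α t).2) (Ioo (-(min ε δ)) (min ε δ)) := by
    rw [contDiffOn_succ_iff_deriv_of_isOpen isOpen_Ioo]
    refine ⟨fun t ht => (h2 t ht).differentiableAt.differentiableWithinAt, by simp, ?_⟩
    rw [contDiffOn_zero]
    refine (hQ.continuousOn.comp hαc fun t ht => ⟨(hsub t ht).2, mem_univ _⟩).congr
      fun t ht => (h2 t ht).deriv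
  have : (2 : ℕ∞ω) = 1 + 1 := by norm_num
  rw [this, contDiffOn_succ_iff_deriv_of_isOpen isOpen_Ioo]
  refine ⟨fun t ht => (h1 t ht).differentiableAt.differentiableWithinAt, by simp, ?_⟩
  rw [zero_add] at hp
  exact hp.congr fun t ht => (h1 t ht).deriv

theorem mvfderiv_one (g : ℝ → ℝ) (t : ℝ) : mvfderiv 𝓘(ℝ, ℝ) g t (1 : ℝ) = deriv g t := by
  refine Eq.trans ?_ (fderiv_apply_one_eq_deriv (f := g) (x := t))
  rw [← mfderiv_eq_fderiv]
  rfl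

section Geodesic
variable {E' : Type*} [NormedAddCommGroup E'] [NormedSpace ℝ E'] [FiniteDimensional ℝ E']
  {H' : Type*} [TopologicalSpace H'] {J : ModelWithCorners ℝ E' H'} [J.Boundaryless]
  {N : Type*} [TopologicalSpace N] [ChartedSpace H' N] [IsManifold J ∞ N]
  [RiemannianBundle (fun y : N => TangentSpace J y)]
  [IsContMDiffRiemannianBundle J ∞ E' (fun y : N => TangentSpace J y)]

omit [J.Boundaryless] [RiemannianBundle (fun y : N => TangentSpace J y)]
  [IsContMDiffRiemannianBundle J ∞ E' (fun y : N => TangentSpace J y)]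
  [FiniteDimensional ℝ E'] in
theorem triv_velocity {β : ℝ → N} {c : ℝ → E'} {y₀ : N} {t : ℝ} {p : E'}
    (hβ : MDifferentiableAt 𝓘(ℝ, ℝ) J β t) (hβt : β t ∈ (chartAt H' y₀).source)
    (hc : HasDerivAt c p t) (h : ∀ᶠ s in 𝓝 t, extChartAt J y₀ (β s) = c s) :
    (trivializationAt E' (TangentSpace J) y₀
      (⟨β t, velocity J β t⟩ : TangentBundle J N)).2 = p := by
  set e := trivializationAt E' (TangentSpace J : N → Type _) y₀
  have hb : β t ∈ e.baseSet := hβt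
  have h1 : (e (⟨β t, velocity J β t⟩ : TangentBundle J N)).2
      = e.continuousLinearMapAt ℝ (β t) (velocity J β t) := by
    rw [e.continuousLinearMapAt_apply ℝ, e.coe_linearMapAt_of_mem hb]
  rw [h1, TangentBundle.continuousLinearMapAt_trivializationAt hβt]
  have h2 : MDifferentiableAt J 𝓘(ℝ, E') (extChartAt J y₀) (β t) := mdifferentiableAt_extChartAt hβt
  have h3 := mfderiv_comp_apply t h2 hβ (1 : ℝ)
  refine h3.symm.trans ?_
  have h4 : (extChartAt J y₀ ∘ β) =ᶠ[𝓝 t] c := h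
  have h5 : mfderiv 𝓘(ℝ, ℝ) 𝓘(ℝ, E') (extChartAt J y₀ ∘ β) t = mfderiv 𝓘(ℝ, ℝ) 𝓘(ℝ, E') c t :=
    h4.mfderiv_eq
  have h6 : mfderiv 𝓘(ℝ, ℝ) 𝓘(ℝ, E') c t (1 : ℝ) = p := by
    rw [mfderiv_eq_fderiv]
    exact (hc.hasFDerivAt.fderiv ▸ by simp : fderiv ℝ c t (1 : ℝ) = p)
  exact (congrArg (fun L => L (1 : ℝ)) h5).trans h6

theorem exists_geodesic (y₀ : N) (w₀ : TangentSpace J y₀) :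
    ∃ ε > 0, ∃ β : ℝ → N, IsGeodesicOn J β (-ε) ε ∧
      (∀ t ∈ Ioo (-ε) ε, MDiffAlongAt 𝓘(ℝ, ℝ) J β (velocity J β) t) ∧
      (⟨β 0, velocity J β 0⟩ : TangentBundle J N) = ⟨y₀, w₀⟩ := by
  set e := trivializationAt E' (fun y : N => TangentSpace J y) y₀ with he
  set b := Module.finBasis ℝ E' with hb
  have := FiniteDimensional.complete ℝ E'
  have hfr : ∀ i, ∀ y ∈ e.baseSet, SmoothAlongAt J J (fun y => y) (e.localFrame b i) y :=
    fun i y hy => contMDiffAt_localFrame_of_mem (I := J) (n := ∞) e b i hy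
  let Γ : Fin (Module.finrank ℝ E') → Fin (Module.finrank ℝ E') → N → E' := fun i j y =>
    (e (⟨y, leviCivita J N (e.localFrame b i) y (e.localFrame b j y)⟩ : TangentBundle J N)).2
  have hΓ : ∀ i j, ContMDiffOn J 𝓘(ℝ, E') ∞ (Γ i j) e.baseSet := fun i j =>
    (e.contMDiffOn_section_iff e.open_baseSet subset_rfl).1 fun y hy =>
      (smoothAlongAt_leviCivita e.open_baseSet hy (hfr j) (hfr i)).contMDiffWithinAt
  set φ := extChartAt J y₀ with hφ
  have hsrc : ∀ x ∈ φ.target, φ.symm x ∈ e.baseSet := fun x hx => by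
    have := φ.map_target hx
    rwa [hφ, extChartAt_source] at this
  let Q : E' × E' → E' := fun z => -∑ i, ∑ j, (b.coord i z.2 * b.coord j z.2) • Γ i j (φ.symm z.1)
  have hcoord : ∀ i, ContDiff ℝ ∞ (b.coord i) := fun i =>
    (b.coord i).toContinuousLinearMap.contDiff
  have hQ : ContDiffOn ℝ 1 Q (φ.target ×ˢ univ) := by
    have hG : ∀ i j, ContDiffOn ℝ ∞ (fun x => Γ i j (φ.symm x)) φ.target := fun i j =>
      contMDiffOn_iff_contDiffOn.1 ((hΓ i j).comp (contMDiffOn_extChartAt_symm y₀) hsrc)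
    have hm : ∀ i, ContDiffOn ℝ ∞ (fun z : E' × E' => b.coord i z.2) (φ.target ×ˢ univ) := fun i =>
      ((hcoord i).comp contDiff_snd).contDiffOn
    have : ContDiffOn ℝ ∞ Q (φ.target ×ˢ univ) :=
      (ContDiffOn.sum fun i _ => ContDiffOn.sum fun j _ => ((hm i).mul (hm j)).smul
        ((hG i j).comp contDiff_fst.contDiffOn fun z hz => hz.1)).neg
    exact this.of_le ENat.LEInfty.out
  obtain ⟨ε, hε, c, p, hc0, hp0, hc2, hcp⟩ := exists_second_order_solution
    (isOpen_extChartAt_target (I := J) y₀) hQ (mem_extChartAt_target (I := J) y₀)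
    (e (⟨y₀, w₀⟩ : TangentBundle J N)).2
  let β : ℝ → N := fun t => φ.symm (c t)
  have hβ0 : β 0 = y₀ := by simp only [β, hc0, hφ]; exact extChartAt_to_inv y₀
  have hβs : ∀ t ∈ Ioo (-ε) ε, β t ∈ e.baseSet := fun t ht => hsrc _ (hcp t ht).1
  have hβ2 : ContMDiffOn 𝓘(ℝ, ℝ) J 2 β (Ioo (-ε) ε) :=
    ContMDiffOn.comp ((contMDiffOn_extChartAt_symm (n := ∞) y₀).of_le ENat.LEInfty.out)
      (contMDiffOn_iff_contDiffOn.2 hc2) fun t ht => (hcp t ht).1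
  have hβd : ∀ t ∈ Ioo (-ε) ε, MDifferentiableAt 𝓘(ℝ, ℝ) J β t := fun t ht =>
    (hβ2.contMDiffAt (isOpen_Ioo.mem_nhds ht)).mdifferentiableAt (by norm_num)
  have hvel : ∀ t ∈ Ioo (-ε) ε, (e (⟨β t, velocity J β t⟩ : TangentBundle J N)).2 = p t := by
    intro t ht
    refine triv_velocity (hβd t ht) (hβs t ht) (hcp t ht).2.1 ?_
    filter_upwards [isOpen_Ioo.mem_nhds ht] with s hs
    exact φ.right_inv (hcp s hs).1
  refine ⟨ε, hε, β, ⟨hβ2, fun t ht => ?_⟩, fun t ht => ?_, ?_⟩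
  · have hv : ∀ᶠ s in 𝓝 t, velocity J β s = ∑ i, b.coord i (p s) • e.localFrame b i (β s) := by
      filter_upwards [isOpen_Ioo.mem_nhds ht] with s hs
      rw [← hvel s hs]
      exact eq_sum_smul_localFrame b (hβs s hs) _
    have hpd : ∀ i, HasDerivAt (fun s => b.coord i (p s)) (b.coord i (Q (c t, p t))) t := fun i =>
      ((b.coord i).toContinuousLinearMap.hasFDerivAt.comp_hasDerivAt t (hcp t ht).2.2)
    have hvt : mfderiv 𝓘(ℝ, ℝ) J β t (1 : ℝ) = ∑ i, b.coord i (p t) • e.localFrame b i (β t) :=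
      hv.self_of_nhds
    refine (pullbackCov_eq_sum (hβd t ht) (fun i => (hfr i _ (hβs t ht)).mdiffAlongAt)
      (fun i => (hpd i).differentiableAt.mdifferentiableAt) hv (1 : ℝ)).trans ?_
    rw [hvt]
    have hdp : ∀ i, mvfderiv 𝓘(ℝ, ℝ) (fun s => b.coord i (p s)) t (1 : ℝ)
        = b.coord i (Q (c t, p t)) := fun i => by
      rw [← (hpd i).deriv, ← mvfderiv_one]
    refine (e.continuousLinearEquivAt ℝ (β t) (hβs t ht)).injective ?_
    have hL : ∀ i, e.continuousLinearEquivAt ℝ (β t) (hβs t ht) (e.localFrame b i (β t)) = b i :=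
      fun i => by
        rw [e.localFrame_apply_of_mem_baseSet b (hβs t ht)]
        have h := e.apply_mk_symm (hβs t ht) (b i)
        simp [Trivialization.basisAt]
        exact congrArg Prod.snd h
    have hL2 : ∀ i j, e.continuousLinearEquivAt ℝ (β t) (hβs t ht)
        (leviCivita J N (e.localFrame b i) (β t) (e.localFrame b j (β t))) = Γ i j (β t) :=
      fun i j => rfl
    simp only [hdp, map_sum, map_add, map_smul, map_zero, hL, hL2, Finset.sum_add_distrib]
    have h1 : ∑ i, b.coord i (Q (c t, p t)) • b i = Q (c t, p t) := b.sum_repr _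
    rw [h1]
    simp only [Q, Finset.smul_sum, smul_smul]
    exact neg_add_cancel _
  · refine (mdiffAlongAt_iff_of_mem e (hβs t ht)).2 ⟨hβd t ht, ?_⟩
    refine (hcp t ht).2.2.differentiableAt.mdifferentiableAt.congr_of_eventuallyEq ?_
    filter_upwards [isOpen_Ioo.mem_nhds ht] with s hs using hvel s hs
  · have h0 : (0 : ℝ) ∈ Ioo (-ε) ε := ⟨by linarith, hε⟩
    have h1 := hvel 0 h0
    rw [hp0] at h1
    refine e.injOn (e.mem_source.2 (hβs 0 h0)) (e.mem_source.2 ?_) ?_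
    · exact mem_baseSet_trivializationAt ..
    · refine Prod.ext ?_ h1
      exact (e.coe_fst' (x := (⟨β 0, velocity J β 0⟩ : TangentBundle J N)) (hβs 0 h0)).trans
        (hβ0.trans (e.coe_fst' (x := (⟨y₀, w₀⟩ : TangentBundle J N))
          (mem_baseSet_trivializationAt ..)).symm)

end Geodesic

theorem sin_angle_starProjection_orthogonal {V : Type*} [NormedAddCommGroup V]
    [InnerProductSpace ℝ V] (S : Submodule ℝ V) [S.HasOrthogonalProjection] (w : V) :
    Real.sin (InnerProductGeometry.angle w (Sᗮ.starProjection w)) ^ 2 * inner ℝ w w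
      = inner ℝ (S.starProjection w) w := by
  set v := Sᗮ.starProjection w
  have h1 : inner ℝ (S.starProjection w) w + inner ℝ v w = inner ℝ w w := by
    rw [← inner_add_left, Submodule.starProjection_add_starProjection_orthogonal]
  have h2 : inner ℝ v w = inner ℝ v v := by
    have h := (Submodule.inner_starProjection_left_eq_right Sᗮ v w).symm
    rwa [Submodule.starProjection_eq_self_iff.2 (Submodule.starProjection_apply_mem _ _),
      eq_comm] at h
  have h3 := InnerProductGeometry.cos_angle_mul_norm_mul_norm w v
  have h4 := Real.sin_sq_add_cos_sq (InnerProductGeometry.angle w v)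
  rw [real_inner_comm, h2, real_inner_self_eq_norm_sq] at h3
  rw [h2, real_inner_self_eq_norm_sq, real_inner_self_eq_norm_sq] at h1
  rw [real_inner_self_eq_norm_sq]
  rcases eq_or_ne ‖v‖ 0 with hv | hv
  · have hv' : v = 0 := norm_eq_zero.1 hv
    rw [hv', InnerProductGeometry.angle_zero_right, Real.sin_pi_div_two]
    rw [hv] at h1
    linarith
  · have h5 : Real.cos (InnerProductGeometry.angle w v) * ‖w‖ = ‖v‖ := by
      apply mul_right_cancel₀ hv
      linarith
    have h6 : Real.cos (InnerProductGeometry.angle w v) ^ 2 * ‖w‖ ^ 2 = ‖v‖ ^ 2 := by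
      rw [← h5]; ring
    have h7 : Real.sin (InnerProductGeometry.angle w v) ^ 2 =
      1 - Real.cos (InnerProductGeometry.angle w v) ^ 2 := by linarith
    rw [h7]
    linarith

section Clairaut
variable {E' : Type*} [NormedAddCommGroup E'] [NormedSpace ℝ E'] [FiniteDimensional ℝ E']
  {H' : Type*} [TopologicalSpace H'] {J : ModelWithCorners ℝ E' H'}
  {N : Type*} [TopologicalSpace N] [ChartedSpace H' N] [IsManifold J ∞ N]
  [RiemannianBundle (fun y : N => TangentSpace J y)]
  [IsContMDiffRiemannianBundle J ∞ E' (fun y : N => TangentSpace J y)]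
  {W U : Set N} {R : Π y : N, Submodule ℝ (TangentSpace J y)} {f : N → ℝ} {k : ℕ}
  {e : Fin k → Π y : N, TangentSpace J y} {y : N}

/-- The Clairaut relation, differentiated along the geodesic with initial velocity `w`. -/
theorem ClairautRelation.deriv_eq [J.Boundaryless] (hC : ClairautRelation J W R f)
    (hf : ContMDiff J 𝓘(ℝ, ℝ) ∞ f) (hU : IsOpen U) (hUW : U ⊆ W)
    (he : ∀ i, ∀ p ∈ U, SmoothAlongAt J J (fun y => y) (e i) p)
    (heR : ∀ p ∈ U, Orthonormal ℝ (fun i => e i p) ∧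
      R p = Submodule.span ℝ (range fun i => e i p)) (hy : y ∈ U) (w : TangentSpace J y) :
    mvfderiv J f y w * ∑ i, inner ℝ (e i y) w ^ 2
      + ∑ i, inner ℝ (e i y) w * inner ℝ (leviCivita J N (e i) y w) w = 0 := by
  obtain ⟨ε, hε, β, hβ, hβv, hβ0⟩ := exists_geodesic (J := J) y w
  suffices hs : mvfderiv J f (β 0) (velocity J β 0) * ∑ i, inner ℝ (e i (β 0)) (velocity J β 0) ^ 2
      + ∑ i, inner ℝ (e i (β 0)) (velocity J β 0) *
        inner ℝ (leviCivita J N (e i) (β 0) (velocity J β 0)) (velocity J β 0) = 0 by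
    let p : TangentBundle J N → Prop := fun z =>
      mvfderiv J f z.proj z.2 * ∑ i, inner ℝ (e i z.proj) z.2 ^ 2
      + ∑ i, inner ℝ (e i z.proj) z.2 * inner ℝ (leviCivita J N (e i) z.proj z.2) z.2 = 0
    have h1 : p ⟨β 0, velocity J β 0⟩ := hs
    rw [hβ0] at h1
    exact h1
  have h0 : (0 : ℝ) ∈ Ioo (-ε) ε := ⟨by linarith, hε⟩
  have hy0 : β 0 = y := congrArg TotalSpace.proj hβ0
  have hU0 : β 0 ∈ U := hy0 ▸ hy
  have hd0 := (hβv 0 h0).mdifferentiableAt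
  obtain ⟨δ, hδ, hball⟩ := Metric.mem_nhds_iff.1 (hd0.continuousAt (hU.mem_nhds hU0))
  have hsub : ∀ t ∈ Ioo (-(min ε δ)) (min ε δ), t ∈ Ioo (-ε) ε ∧ β t ∈ U := by
    intro t ht
    refine ⟨⟨by linarith [ht.1, min_le_left ε δ], by linarith [ht.2, min_le_left ε δ]⟩,
      hball ?_⟩
    rw [Metric.mem_ball, Real.dist_eq, sub_zero, abs_lt]
    exact ⟨by linarith [ht.1, min_le_right ε δ], by linarith [ht.2, min_le_right ε δ]⟩
  have hδ0 : (0 : ℝ) ∈ Ioo (-(min ε δ)) (min ε δ) := ⟨by simp [hε, hδ], by simp [hε, hδ]⟩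
  obtain ⟨c, hc⟩ := hC _ _ β ⟨hβ.1.mono fun t ht => (hsub t ht).1,
    fun t ht => hβ.2 t (hsub t ht).1⟩ fun t ht => hUW (hsub t ht).2
  have key : ∀ t ∈ Ioo (-(min ε δ)) (min ε δ),
      Real.exp (f (β t)) ^ 2 * ∑ i, inner ℝ (e i (β t)) (velocity J β t) ^ 2
        = c ^ 2 * inner ℝ (velocity J β t) (velocity J β t) := by
    intro t ht
    rw [← hc t ht, mul_pow, mul_assoc, sin_angle_starProjection_orthogonal,
      starProjection_eq_sum_of_orthonormal (heR _ (hsub t ht).2).1 (heR _ (hsub t ht).2).2,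
      sum_inner]
    congr 1
    refine Finset.sum_congr rfl fun i _ => ?_
    rw [real_inner_smul_left, sq]
  have hg0 : pullbackCov 𝓘(ℝ, ℝ) J β (velocity J β) 0 (1 : ℝ) = 0 := hβ.2 0 h0
  have hv0 := hβv 0 h0
  have hei : ∀ i, MDiffAlongAt J J (fun y => y) (e i) (β 0) := fun i =>
    (he i _ hU0).mdiffAlongAt
  have hdf : MDifferentiableAt J 𝓘(ℝ, ℝ) f (β 0) := (hf _).mdifferentiableAt (by simp)
  have d1 : HasDerivAt (fun t => f (β t)) (mvfderiv J f (β 0) (velocity J β 0)) 0 := by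
    have h1 : mvfderiv 𝓘(ℝ, ℝ) (f ∘ β) (0 : ℝ) (1 : ℝ) = mvfderiv J f (β 0) (velocity J β 0) :=
      mvfderiv_comp_apply (0 : ℝ) hdf hd0 (1 : ℝ)
    rw [← h1, mvfderiv_one]
    exact (hdf.comp (0 : ℝ) hd0).differentiableAt.hasDerivAt
  have d2 : ∀ i, HasDerivAt (fun t => inner ℝ (e i (β t)) (velocity J β t))
      (inner ℝ (leviCivita J N (e i) (β 0) (velocity J β 0)) (velocity J β 0)) 0 := by
    intro i
    have h1 := mvfderiv_inner_along ((hei i).comp hd0) hv0 (1 : ℝ)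
    rw [hg0, inner_zero_right, add_zero] at h1
    have h3 := congrArg (fun z => inner ℝ z (velocity J β 0)) (pullbackCov_comp hd0 (hei i) (1 : ℝ))
    have h2 : inner ℝ (leviCivita J N (e i) (β 0) (velocity J β 0)) (velocity J β 0)
      = deriv (fun t => inner ℝ (e i (β t)) (velocity J β t)) 0 :=
        (h1.trans h3).symm.trans (mvfderiv_one _ _)
    rw [h2]
    exact (((hei i).comp hd0).inner hv0).differentiableAt.hasDerivAt
  have d3 : HasDerivAt (fun t => inner ℝ (velocity J β t) (velocity J β t)) 0 0 := by
    have h1 := mvfderiv_inner_along hv0 hv0 (1 : ℝ)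
    rw [hg0, inner_zero_right, inner_zero_left, add_zero] at h1
    have h2 : (0 : ℝ) = deriv (fun t => inner ℝ (velocity J β t) (velocity J β t)) 0 :=
      h1.symm.trans (mvfderiv_one _ _)
    have h3 := (hv0.inner hv0).differentiableAt.hasDerivAt
    rwa [← h2] at h3
  have d4 := (d1.exp.pow 2).mul (HasDerivAt.fun_sum (u := Finset.univ) fun i _ => (d2 i).pow 2)
  have d5 := (d3.const_mul (c ^ 2)).congr_of_eventuallyEq
    (Filter.eventually_of_mem (isOpen_Ioo.mem_nhds hδ0) key)
  have d6 := d4.unique d5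
  simp only [Pi.pow_apply, mul_zero] at d6
  have h2 : ∑ i, ((2 : ℕ) : ℝ) * inner ℝ (e i (β 0)) (velocity J β 0) ^ (2 - 1) *
      inner ℝ (leviCivita J N (e i) (β 0) (velocity J β 0)) (velocity J β 0)
      = 2 * ∑ i, inner ℝ (e i (β 0)) (velocity J β 0) *
        inner ℝ (leviCivita J N (e i) (β 0) (velocity J β 0)) (velocity J β 0) := by
    rw [Finset.mul_sum]
    refine Finset.sum_congr rfl fun i _ => ?_
    norm_num
    ring
  rw [h2] at d6
  have hexp : Real.exp (f (β 0)) ^ 2 ≠ 0 := by positivity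
  refine (mul_eq_zero.1 (?_ : (2 * Real.exp (f (β 0)) ^ 2) * _ = 0)).resolve_left
    (mul_ne_zero two_ne_zero hexp)
  norm_num at d6
  linear_combination d6

theorem leviCivita_inner_eq_neg {V V' : Π y : N, TangentSpace J y}
    (hV : MDiffAlongAt J J (fun y => y) V y) (hV' : MDiffAlongAt J J (fun y => y) V' y) {c : ℝ}
    (h : ∀ᶠ p in 𝓝 y, inner ℝ (V p) (V' p) = c) (w : TangentSpace J y) :
    inner ℝ (leviCivita J N V y w) (V' y) = - inner ℝ (V y) (leviCivita J N V' y w) := by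
  have h1 := mvfderiv_inner hV hV' w
  rw [mvfderiv_congr (g := fun _ => c) h, mvfderiv_const] at h1
  have h2 : (0 : ℝ) = inner ℝ (leviCivita J N V y w) (V' y) +
    inner ℝ (V y) (leviCivita J N V' y w) := h1
  linarith

theorem exists_smooth_normal (hU : IsOpen U)
    (he : ∀ i, ∀ p ∈ U, SmoothAlongAt J J (fun y => y) (e i) p)
    (heR : ∀ p ∈ U, Orthonormal ℝ (fun i => e i p) ∧
      R p = Submodule.span ℝ (range fun i => e i p)) (hy : y ∈ U) {v : TangentSpace J y}
    (hv : v ∈ (R y)ᗮ) :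
    ∃ t ⊆ U, IsOpen t ∧ y ∈ t ∧ ∃ V : Π y : N, TangentSpace J y, V y = v ∧
      ∀ p ∈ t, SmoothAlongAt J J (fun y => y) V p ∧ V p ∈ (R p)ᗮ := by
  obtain ⟨t, ht, hyt, V, hVy, hV⟩ := exists_smooth_extend v
  have hp : ∀ p ∈ U, V p - ∑ i, inner ℝ (e i p) (V p) • e i p = (R p)ᗮ.starProjection (V p) :=
    fun p hp => by
      rw [Submodule.starProjection_orthogonal_val,
        starProjection_eq_sum_of_orthonormal (heR p hp).1 (heR p hp).2]
  refine ⟨U ∩ t, inter_subset_left, hU.inter ht, ⟨hy, hyt⟩,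
    fun p => V p - ∑ i, inner ℝ (e i p) (V p) • e i p, ?_, fun p hpt => ⟨?_, ?_⟩⟩
  · show V y - ∑ i, inner ℝ (e i y) (V y) • e i y = v
    rw [hp y hy, hVy]
    exact Submodule.starProjection_eq_self_iff.2 hv
  · exact (hV p hpt.2).sub (SmoothAlongAt.sum _ contMDiffAt_id fun i _ =>
      (he i p hpt.1).smul ((he i p hpt.1).inner (hV p hpt.2)))
  · show V p - ∑ i, inner ℝ (e i p) (V p) • e i p ∈ _
    rw [hp p hpt.1]
    exact Submodule.starProjection_apply_mem _ _

/-- A local section of a totally geodesic distribution. -/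
theorem IsTotallyGeodesicOn.of_local [T2Space N] {S : Π y : N, Submodule ℝ (TangentSpace J y)}
    (hS : IsTotallyGeodesicOn J S W) {t : Set N} (ht : IsOpen t) (hy : y ∈ t)
    (hyW : y ∈ W) {V V' : Π y : N, TangentSpace J y}
    (hV : ∀ p ∈ t, SmoothAlongAt J J (fun y => y) V p ∧ V p ∈ S p)
    (hV' : ∀ p ∈ t, SmoothAlongAt J J (fun y => y) V' p ∧ V' p ∈ S p) :
    leviCivita J N V y (V' y) ∈ S y := by
  obtain ⟨ψ, h1, h0, hψ⟩ := exists_cutoff (I := J) (J := J) (F := fun y : N => y)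
    contMDiff_id (ht.mem_nhds hy)
  have hs : ∀ V : Π y : N, TangentSpace J y,
      (∀ p ∈ t, SmoothAlongAt J J (fun y => y) V p ∧ V p ∈ S p) →
      IsSmoothFieldOn J (fun p => ψ p • V p) W ∧ ∀ p ∈ W, ψ p • V p ∈ S p := fun V hV =>
    ⟨fun p _ => (hψ V (fun p hp => (hV p hp).1) p).contMDiffWithinAt, fun p _ => by
      by_cases hp : p ∈ t
      · exact Submodule.smul_mem _ _ (hV p hp).2
      · rw [h0 p hp, zero_smul]; exact Submodule.zero_mem _⟩
  have := hS _ _ (hs V' hV').1 (hs V' hV').2 (hs V hV).1 (hs V hV).2 y hyW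
  rw [h1.self_of_nhds, one_smul, leviCivita_congr
    (hψ V (fun p hp => (hV p hp).1) y).mdiffAlongAt (hV y hy).1.mdiffAlongAt
    (h1.mono fun p hp => by rw [hp, one_smul])] at this
  exact this

/-- Consequences of the Clairaut relation at a point: `f` is constant along `R`, and the fibres of
`R` are umbilic with mean curvature `-∇f`. -/
theorem ClairautRelation.pointwise [T2Space N] [J.Boundaryless] (hC : ClairautRelation J W R f)
    (hf : ContMDiff J 𝓘(ℝ, ℝ) ∞ f) (hW : IsOpen W)
    (hRs : IsSmoothSubbundleOn J J (fun y : N => y) R W)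
    (hR : IsTotallyGeodesicOn J (fun y => (R y)ᗮ) W) (hy : y ∈ W) :
    (∀ u ∈ R y, mvfderiv J f y u = 0) ∧
    ∀ v ∈ (R y)ᗮ, ∃ t ⊆ W, IsOpen t ∧ y ∈ t ∧ ∃ V : Π y : N, TangentSpace J y, V y = v ∧
      (∀ p ∈ t, SmoothAlongAt J J (fun y => y) V p ∧ V p ∈ (R p)ᗮ) ∧
      ∀ u ∈ R y, inner ℝ u (leviCivita J N V y u) = inner ℝ u u * mvfderiv J f y v := by
  obtain ⟨U₀, hU₀, hyU₀, k, e, he₀, heR₀⟩ := hRs.exists_orthonormal hy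
  set U := U₀ ∩ W
  have hU : IsOpen U := hU₀.inter hW
  have hyU : y ∈ U := ⟨hyU₀, hy⟩
  have he : ∀ i, ∀ p ∈ U, SmoothAlongAt J J (fun y => y) (e i) p := fun i p hp => he₀ i p hp.1
  have heR : ∀ p ∈ U, Orthonormal ℝ (fun i => e i p) ∧
      R p = Submodule.span ℝ (range fun i => e i p) := fun p hp => heR₀ p hp.1
  have hproj : ∀ u ∈ R y, ∑ i, inner ℝ (e i y) u • e i y = u := fun u hu => by
    rw [← starProjection_eq_sum_of_orthonormal (heR y hyU).1 (heR y hyU).2]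
    exact Submodule.starProjection_eq_self_iff.2 hu
  have hmem : ∀ p ∈ U, ∀ i, e i p ∈ R p := fun p hp i => by
    rw [(heR p hp).2]
    exact Submodule.subset_span ⟨i, rfl⟩
  have main : ∀ u ∈ R y, ∀ v ∈ (R y)ᗮ,
      mvfderiv J f y (u + v) * inner ℝ u u
        + inner ℝ (leviCivita J N (fun p => ∑ i, inner ℝ (e i y) u • e i p) y (u + v)) v = 0 := by
    intro u hu v hv
    have h1 := hC.deriv_eq hf hU inter_subset_right he heR hyU (u + v)
    have h2 : ∀ i, inner ℝ (e i y) (u + v) = inner ℝ (e i y) u := fun i => by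
      rw [inner_add_right, Submodule.inner_right_of_mem_orthogonal (hmem y hyU i) hv, add_zero]
    simp only [h2] at h1
    have h3 : ∑ i, inner ℝ (e i y) u ^ 2 = inner ℝ u u := by
      have h := congrArg (fun z => inner ℝ z u) (hproj u hu)
      simp only [sum_inner, real_inner_smul_left] at h
      simpa only [sq] using h
    obtain ⟨hmd, h4⟩ := leviCivita_sum_smul Finset.univ (c := fun i _ => inner ℝ (e i y) u)
      (V := e) (x := y) (fun i _ => mdifferentiableAt_const)
      (fun i _ => (he i y hyU).mdiffAlongAt) (u + v)
    have h5 : ∑ i, inner ℝ (e i y) u * inner ℝ (leviCivita J N (e i) y (u + v)) (u + v)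
        = inner ℝ (leviCivita J N (fun p => ∑ i, inner ℝ (e i y) u • e i p) y (u + v)) (u + v) := by
      rw [h4, sum_inner]
      refine Finset.sum_congr rfl fun i _ => ?_
      rw [mvfderiv_const, inner_add_left, real_inner_smul_left, real_inner_smul_left]
      simp only [zero_apply, zero_mul, zero_add]
    have h6 := leviCivita_inner_eq_neg hmd hmd (c := inner ℝ u u) (by
      filter_upwards [hU.mem_nhds hyU] with p hp
      rw [(heR p hp).1.inner_sum, ← h3]
      exact Finset.sum_congr rfl fun i _ => by simp [sq]) (u + v)
    rw [real_inner_comm, hproj u hu] at h6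
    rw [h5, h3, inner_add_right] at h1
    have h7 : inner ℝ (leviCivita J N (fun p => ∑ i, inner ℝ (e i y) u • e i p) y (u + v)) u
      = 0 := by rw [real_inner_comm]; linarith
    rw [h7, zero_add] at h1
    exact h1
  have hA : ∀ u ∈ R y, mvfderiv J f y u = 0 := by
    intro u hu
    rcases eq_or_ne u 0 with rfl | hu0
    · exact map_zero _
    have h := main u hu 0 (Submodule.zero_mem _)
    rw [add_zero, inner_zero_right, add_zero] at h
    exact (mul_eq_zero.1 h).resolve_right (inner_self_ne_zero.2 hu0)
  refine ⟨hA, fun v hv => ?_⟩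
  obtain ⟨t, htU, ht, hyt, V, hVy, hV⟩ := exists_smooth_normal hU he heR hyU hv
  refine ⟨t, htU.trans inter_subset_right, ht, hyt, V, hVy, hV, fun u hu => ?_⟩
  have hmd := (leviCivita_sum_smul Finset.univ (c := fun i _ => inner ℝ (e i y) u)
      (V := e) (x := y) (fun i _ => mdifferentiableAt_const)
      (fun i _ => (he i y hyU).mdiffAlongAt) 0).1
  have h1 := fun w => leviCivita_inner_eq_neg hmd (hV y hyt).1.mdiffAlongAt (c := 0) (by
    filter_upwards [ht.mem_nhds hyt] with p hp
    exact Submodule.inner_right_of_mem_orthogonal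
      (Submodule.sum_mem _ fun i _ => Submodule.smul_mem _ _ (hmem p (htU hp) i)) (hV p hp).2) w
  have h2 := main u hu v hv
  have h3 : inner ℝ u (leviCivita J N V y v) = 0 := by
    have := hR.of_local ht hyt hy hV hV
    rw [hVy] at this
    exact Submodule.inner_right_of_mem_orthogonal hu this
  rw [← hVy, h1, hproj u hu, map_add, map_add, inner_add_right, hVy, h3, hA u hu] at h2
  linarith

end Clairaut

section RiemannianMaps
variable {E : Type*} [NormedAddCommGroup E] [NormedSpace ℝ E] [FiniteDimensional ℝ E]
  {H : Type*} [TopologicalSpace H] {I : ModelWithCorners ℝ E H}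
  {M : Type*} [TopologicalSpace M] [ChartedSpace H M] [IsManifold I ∞ M]
  [RiemannianBundle (fun x : M => TangentSpace I x)]
  [IsContMDiffRiemannianBundle I ∞ E (fun x : M => TangentSpace I x)]
  {E' : Type*} [NormedAddCommGroup E'] [NormedSpace ℝ E'] [FiniteDimensional ℝ E']
  {H' : Type*} [TopologicalSpace H'] {J : ModelWithCorners ℝ E' H'}
  {N : Type*} [TopologicalSpace N] [ChartedSpace H' N] [IsManifold J ∞ N]
  [RiemannianBundle (fun y : N => TangentSpace J y)]
  [IsContMDiffRiemannianBundle J ∞ E' (fun y : N => TangentSpace J y)]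
  {F : M → N} {q : M} {X Y Z : Π q : M, TangentSpace I q}

theorem mem_kerSpace {x : TangentSpace I q} : x ∈ kerSpace I J F q ↔ mfderiv I J F q x = 0 :=
  LinearMap.mem_ker

theorem mfderiv_mem_rangeSpace (x : TangentSpace I q) :
    mfderiv I J F q x ∈ rangeSpace I J F q :=
  LinearMap.mem_range_self _ x

theorem adjDeriv_mem_horSpace (w : TangentSpace J (F q)) :
    adjDeriv I J F q w ∈ horSpace I J F q := by
  refine (Submodule.mem_orthogonal _ _).2 fun k hk => ?_
  rw [inner_adjDeriv, mem_kerSpace.1 hk, inner_zero_left]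

theorem IsRiemannianMap.adjDeriv_mfderiv (hF : IsRiemannianMap I J F) {x : TangentSpace I q}
    (hx : x ∈ horSpace I J F q) : adjDeriv I J F q (mfderiv I J F q x) = x := by
  refine ext_inner_left ℝ fun v => ?_
  rw [inner_adjDeriv]
  have hv := Submodule.starProjection_add_starProjection_orthogonal (K := kerSpace I J F q) v
  have hk := Submodule.starProjection_apply_mem (kerSpace I J F q) v
  conv_lhs => rw [← hv, map_add, mem_kerSpace.1 hk, zero_add]
  conv_rhs => rw [← hv, inner_add_left, Submodule.inner_right_of_mem_orthogonal hk hx, zero_add]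
  exact hF.inner_eq q _ (Submodule.starProjection_apply_mem _ _) x hx

theorem IsRiemannianMap.inner_mfderiv (hF : IsRiemannianMap I J F) {x : TangentSpace I q}
    (hx : x ∈ horSpace I J F q) (v : TangentSpace I q) :
    inner ℝ (mfderiv I J F q v) (mfderiv I J F q x) = inner ℝ v x := by
  rw [← inner_adjDeriv, hF.adjDeriv_mfderiv hx]

theorem IsRiemannianMap.mfderiv_adjDeriv (hF : IsRiemannianMap I J F) {w : TangentSpace J (F q)}
    (hw : w ∈ rangeSpace I J F q) : mfderiv I J F q (adjDeriv I J F q w) = w := by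
  obtain ⟨x, hx⟩ := LinearMap.mem_range.1 hw
  have hv := Submodule.starProjection_add_starProjection_orthogonal (K := kerSpace I J F q) x
  have hk := Submodule.starProjection_apply_mem (kerSpace I J F q) x
  have hx' : mfderiv I J F q ((kerSpace I J F q)ᗮ.starProjection x) = w := by
    refine Eq.trans ?_ hx
    conv_rhs => rw [← hv]
    exact (((mfderiv I J F q).map_add _ _).trans (by rw [mem_kerSpace.1 hk, zero_add])).symm
  rw [← hx']
  exact congrArg _ (hF.adjDeriv_mfderiv (Submodule.starProjection_apply_mem _ _))

theorem IsRiemannianMap.sub_adjDeriv_mem_kerSpace (hF : IsRiemannianMap I J F)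
    (x : TangentSpace I q) : x - adjDeriv I J F q (mfderiv I J F q x) ∈ kerSpace I J F q := by
  rw [mem_kerSpace, map_sub, hF.mfderiv_adjDeriv (mfderiv_mem_rangeSpace x), sub_self]

theorem exists_smooth_field [T2Space M] (v : TangentSpace I q) :
    ∃ V : Π p : M, TangentSpace I p, V q = v ∧ ∀ p, SmoothAlongAt I I (fun p => p) V p := by
  obtain ⟨t, ht, hqt, V, hVq, hV⟩ := exists_smooth_extend v
  obtain ⟨ψ, h1, -, hψ⟩ := exists_cutoff (I := I) (J := I) (F := fun p : M => p)
    contMDiff_id (ht.mem_nhds hqt)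
  exact ⟨fun p => ψ p • V p, by simp [h1.self_of_nhds, hVq], hψ V hV⟩

theorem SmoothAlongAt.mfderiv_map (hF : ContMDiff I J ∞ F)
    (hX : SmoothAlongAt I I (fun p => p) X q) :
    SmoothAlongAt I J F (fun p => mfderiv I J F p (X p)) q :=
  smoothAlongAt_mfderiv isOpen_univ (mem_univ q) hF.contMDiffOn hX

theorem exists_horizontal_field [T2Space M] (hF : IsRiemannianMap I J F)
    {w : TangentSpace J (F q)} (hw : w ∈ rangeSpace I J F q) :
    ∃ X : Π p : M, TangentSpace I p, mfderiv I J F q (X q) = w ∧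
      (∀ p, SmoothAlongAt I I (fun p => p) X p) ∧ ∀ p, X p ∈ horSpace I J F p := by
  obtain ⟨V, hVq, hV⟩ := exists_smooth_field (adjDeriv I J F q w)
  refine ⟨fun p => adjDeriv I J F p (mfderiv I J F p (V p)), ?_,
    fun p => smoothAlongAt_adjDeriv hF.smooth ((hV p).mfderiv_map hF.smooth),
    fun p => adjDeriv_mem_horSpace _⟩
  show mfderiv I J F q (adjDeriv I J F q (mfderiv I J F q (V q))) = w
  rw [hVq, hF.mfderiv_adjDeriv hw, hF.mfderiv_adjDeriv hw]

theorem exists_vertical_field [T2Space M] (hF : IsRiemannianMap I J F)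
    {k : TangentSpace I q} (hk : k ∈ kerSpace I J F q) :
    ∃ X : Π p : M, TangentSpace I p, X q = k ∧
      (∀ p, SmoothAlongAt I I (fun p => p) X p) ∧ ∀ p, X p ∈ kerSpace I J F p := by
  obtain ⟨V, hVq, hV⟩ := exists_smooth_field k
  refine ⟨fun p => V p - adjDeriv I J F p (mfderiv I J F p (V p)), ?_,
    fun p => (hV p).sub (smoothAlongAt_adjDeriv hF.smooth ((hV p).mfderiv_map hF.smooth)),
    fun p => hF.sub_adjDeriv_mem_kerSpace _⟩
  show V q - adjDeriv I J F q (mfderiv I J F q (V q)) = k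
  rw [hVq, mem_kerSpace.1 hk, map_zero, sub_zero]

theorem pullbackCov_mfderiv (X Y : Π q : M, TangentSpace I q) (q : M) :
    pullbackCov I J F (fun p => mfderiv I J F p (Y p)) q (X q)
      = secondFundForm I J F X Y q + mfderiv I J F q (leviCivita I M Y q (X q)) :=
  (sub_add_cancel _ _).symm

theorem secondFundForm_comm (hF : ContMDiff I J ∞ F)
    (hX : ∀ p, SmoothAlongAt I I (fun p => p) X p) (hY : ∀ p, SmoothAlongAt I I (fun p => p) Y p) :
    secondFundForm I J F X Y q = secondFundForm I J F Y X q := by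
  have h1 := pullbackCov_mfderiv_sub hF isOpen_univ (mem_univ q) (fun p _ => hX p) (fun p _ => hY p)
  rw [← leviCivita_sub_eq_mlieBracket (hX q).mdiffAlongAt (hY q).mdiffAlongAt, map_sub] at h1
  rw [← sub_eq_zero] at h1 ⊢
  rw [← h1]
  simp only [secondFundForm]
  abel

theorem secondFundForm_add_right (hF : ContMDiff I J ∞ F)
    (hY : ∀ p, SmoothAlongAt I I (fun p => p) Y p) (hZ : ∀ p, SmoothAlongAt I I (fun p => p) Z p) :
    secondFundForm I J F X (fun p => Y p + Z p) q
      = secondFundForm I J F X Y q + secondFundForm I J F X Z q := by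
  have h1 := pullbackCov_add ((hY q).mfderiv_map hF).mdiffAlongAt
    ((hZ q).mfderiv_map hF).mdiffAlongAt (X q)
  simp only [secondFundForm]
  rw [leviCivita_add (hY q).mdiffAlongAt (hZ q).mdiffAlongAt, add_apply, map_add]
  simp only [map_add]
  rw [h1]
  abel

theorem secondFundForm_add_left (hF : ContMDiff I J ∞ F)
    (hX : ∀ p, SmoothAlongAt I I (fun p => p) X p)
    (hY : ∀ p, SmoothAlongAt I I (fun p => p) Y p) (hZ : ∀ p, SmoothAlongAt I I (fun p => p) Z p) :
    secondFundForm I J F (fun p => Y p + Z p) X q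
      = secondFundForm I J F Y X q + secondFundForm I J F Z X q := by
  rw [secondFundForm_comm hF (fun p => (hY p).add (hZ p)) hX, secondFundForm_add_right hF hY hZ,
    secondFundForm_comm hF hX hY, secondFundForm_comm hF hX hZ]

theorem pullbackCov_inner_eq_neg {σ τ : Π q : M, TangentSpace J (F q)}
    (hσ : MDiffAlongAt I J F σ q) (hτ : MDiffAlongAt I J F τ q)
    (h : ∀ᶠ p in 𝓝 q, inner ℝ (σ p) (τ p) = 0) (v : TangentSpace I q) :
    inner ℝ (pullbackCov I J F σ q v) (τ q) = - inner ℝ (σ q) (pullbackCov I J F τ q v) := by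
  have h1 := mvfderiv_inner_along hσ hτ v
  rw [mvfderiv_congr (g := fun _ => 0) h, mvfderiv_const] at h1
  have h2 : (0 : ℝ) = inner ℝ (pullbackCov I J F σ q v) (τ q) +
    inner ℝ (σ q) (pullbackCov I J F τ q v) := h1
  linarith

/-- For horizontal fields the second fundamental form is normal. -/
theorem secondFundForm_mem_orthogonal [T2Space M] (hF : IsRiemannianMap I J F)
    (hX : ∀ p, SmoothAlongAt I I (fun p => p) X p) (hY : ∀ p, SmoothAlongAt I I (fun p => p) Y p)
    (hXh : ∀ p, X p ∈ horSpace I J F p) (hYh : ∀ p, Y p ∈ horSpace I J F p) :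
    secondFundForm I J F X Y q ∈ (rangeSpace I J F q)ᗮ := by
  have anti : ∀ X Y Z : Π q : M, TangentSpace I q,
      (∀ p, SmoothAlongAt I I (fun p => p) Y p) → (∀ p, SmoothAlongAt I I (fun p => p) Z p) →
      (∀ p, Y p ∈ horSpace I J F p) → (∀ p, Z p ∈ horSpace I J F p) →
      inner ℝ (secondFundForm I J F X Y q) (mfderiv I J F q (Z q))
        = - inner ℝ (secondFundForm I J F X Z q) (mfderiv I J F q (Y q)) := by
    intro X Y Z hY hZ hYh hZh
    have h1 := mvfderiv_inner_along ((hY q).mfderiv_map hF.smooth).mdiffAlongAt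
      ((hZ q).mfderiv_map hF.smooth).mdiffAlongAt (X q)
    rw [mvfderiv_congr (g := fun p => inner ℝ (Y p) (Z p))
      (Filter.Eventually.of_forall fun p => hF.inner_eq p _ (hYh p) _ (hZh p)),
      mvfderiv_inner (hY q).mdiffAlongAt (hZ q).mdiffAlongAt, pullbackCov_mfderiv,
      pullbackCov_mfderiv, inner_add_left, inner_add_right, hF.inner_mfderiv (hZh q),
      real_inner_comm _ (mfderiv I J F q (Y q)), real_inner_comm _ (mfderiv I J F q (Y q)),
      hF.inner_mfderiv (hYh q), real_inner_comm _ (Y q)] at h1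
    linarith
  refine (Submodule.mem_orthogonal' _ _).2 fun w hw => ?_
  obtain ⟨Z, rfl, hZ, hZh⟩ := exists_horizontal_field hF hw
  have e1 := anti X Y Z hY hZ hYh hZh
  have e2 := anti Z X Y hX hY hXh hYh
  have e3 := anti Y Z X hZ hX hZh hXh
  rw [secondFundForm_comm hF.smooth hX hZ] at e1
  rw [secondFundForm_comm hF.smooth hZ hY] at e2
  rw [secondFundForm_comm hF.smooth hY hX] at e3
  linarith

theorem inner_gradient (f : N → ℝ) (y : N) (w : TangentSpace J y) :
    inner ℝ w (gradient J f y) = mvfderiv J f y w := by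
  rw [real_inner_comm]
  exact InnerProductSpace.toDual_symm_apply

section Clairaut
variable {P : Π y : N, TangentSpace J y →L[ℝ] TangentSpace J y}
  {D₁ D₂ : Π q : M, Submodule ℝ (TangentSpace J (F q))}
  {W : Set N} {R : Π y : N, Submodule ℝ (TangentSpace J y)} {f : N → ℝ}
  [T2Space M] [T2Space N] [J.Boundaryless]

theorem IsCSIRM.gradient_mem_orthogonal (hF : IsCSIRM I J P F D₁ D₂ W R f)
    (hR : IsTotallyGeodesicOn J (fun y => (R y)ᗮ) W) (q : M) :
    gradient J f (F q) ∈ (rangeSpace I J F q)ᗮ := by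
  have h := (hF.clairaut.pointwise hF.smooth hF.rangeDistribution.isOpen
    hF.rangeDistribution.smooth hR (hF.rangeDistribution.mem q)).1
  refine (Submodule.mem_orthogonal _ _).2 fun w hw => ?_
  rw [inner_gradient]
  exact h w (by rwa [hF.rangeDistribution.apply_eq])

theorem IsCSIRM.secondFundForm_self (hF : IsCSIRM I J P F D₁ D₂ W R f)
    (hR : IsTotallyGeodesicOn J (fun y => (R y)ᗮ) W)
    (hX : ∀ p, SmoothAlongAt I I (fun p => p) X p) (hXh : ∀ p, X p ∈ horSpace I J F p) (q : M) :
    secondFundForm I J F X X q = -(inner ℝ (X q) (X q) • gradient J f (F q)) := by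
  rw [← sub_eq_zero, sub_neg_eq_add]
  set z := secondFundForm I J F X X q + inner ℝ (X q) (X q) • gradient J f (F q) with hz
  have hmem : z ∈ (rangeSpace I J F q)ᗮ := Submodule.add_mem _
    (secondFundForm_mem_orthogonal hF.riemannian hX hX hXh hXh)
    (Submodule.smul_mem _ _ (hF.gradient_mem_orthogonal hR q))
  obtain ⟨t, -, ht, hqt, V, hVq, hV, hu⟩ := (hF.clairaut.pointwise hF.smooth
    hF.rangeDistribution.isOpen hF.rangeDistribution.smooth hR (hF.rangeDistribution.mem q)).2 z
    (by rwa [hF.rangeDistribution.apply_eq])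
  have hFd : MDifferentiableAt I J F q := (hF.riemannian.smooth q).mdifferentiableAt (by simp)
  have hVd := (hV _ hqt).1.mdiffAlongAt
  have h1 := pullbackCov_inner_eq_neg ((hX q).mfderiv_map hF.riemannian.smooth).mdiffAlongAt
    (hVd.comp hFd) (by
      filter_upwards [hF.riemannian.smooth.continuous.continuousAt (ht.mem_nhds hqt)] with p hp
      refine Submodule.inner_right_of_mem_orthogonal (mfderiv_mem_rangeSpace (X p)) ?_
      rw [← hF.rangeDistribution.apply_eq]
      exact (hV _ hp).2) (X q)
  rw [pullbackCov_comp hFd hVd, hu _ (by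
    rw [hF.rangeDistribution.apply_eq]; exact mfderiv_mem_rangeSpace _), hVq,
    pullbackCov_mfderiv, inner_add_left,
    Submodule.inner_right_of_mem_orthogonal (mfderiv_mem_rangeSpace _) hmem, add_zero,
    hF.riemannian.inner_mfderiv (hXh q), ← inner_gradient, real_inner_comm _ z] at h1
  rw [← inner_self_eq_zero (𝕜 := ℝ)]
  nth_rewrite 1 [hz]
  rw [inner_add_left, h1, real_inner_smul_left]
  ring

/-- A Clairaut map is umbilic: `(∇F_*)(X, Y) = - ⟨X, Y⟩ ∇f` for horizontal `X`, `Y`. -/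
theorem IsCSIRM.secondFundForm_eq (hF : IsCSIRM I J P F D₁ D₂ W R f)
    (hR : IsTotallyGeodesicOn J (fun y => (R y)ᗮ) W)
    (hX : ∀ p, SmoothAlongAt I I (fun p => p) X p) (hY : ∀ p, SmoothAlongAt I I (fun p => p) Y p)
    (hXh : ∀ p, X p ∈ horSpace I J F p) (hYh : ∀ p, Y p ∈ horSpace I J F p) (q : M) :
    secondFundForm I J F X Y q = -(inner ℝ (X q) (Y q) • gradient J f (F q)) := by
  have hs := hF.riemannian.smooth
  have hXY : ∀ p, SmoothAlongAt I I (fun p => p) (fun p => X p + Y p) p :=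
    fun p => (hX p).add (hY p)
  have h := hF.secondFundForm_self hR hXY (fun p => Submodule.add_mem _ (hXh p) (hYh p)) q
  rw [secondFundForm_add_right hs hX hY, secondFundForm_add_left hs hX hX hY,
    secondFundForm_add_left hs hY hX hY, secondFundForm_comm hs hY hX,
    hF.secondFundForm_self hR hX hXh, hF.secondFundForm_self hR hY hYh, real_inner_add_add_self]
    at h
  have h2 : (2 : ℝ) • (secondFundForm I J F X Y q + inner ℝ (X q) (Y q) • gradient J f (F q))
      = 0 := by
    rw [← sub_eq_zero] at h
    rw [← h]
    module
  have h3 := (smul_eq_zero.1 h2).resolve_left two_ne_zero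
  exact eq_neg_of_add_eq_zero_left h3

/-- The Weingarten formula for a normal field along a Clairaut map. -/
theorem IsCSIRM.tanPart_pullbackCov (hF : IsCSIRM I J P F D₁ D₂ W R f)
    (hR : IsTotallyGeodesicOn J (fun y => (R y)ᗮ) W)
    (hX : ∀ p, SmoothAlongAt I I (fun p => p) X p) (hXh : ∀ p, X p ∈ horSpace I J F p)
    {η : Π q : M, TangentSpace J (F q)} (hη : ∀ p, SmoothAlongAt I J F η p)
    (hηn : ∀ p, η p ∈ (rangeSpace I J F p)ᗮ) (q : M) :
    tanPart I J F q (pullbackCov I J F η q (X q))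
      = inner ℝ (η q) (gradient J f (F q)) • mfderiv I J F q (X q) := by
  rw [← sub_eq_zero]
  set z := tanPart I J F q (pullbackCov I J F η q (X q))
    - inner ℝ (η q) (gradient J f (F q)) • mfderiv I J F q (X q) with hz
  have hzm : z ∈ rangeSpace I J F q := Submodule.sub_mem _
    (Submodule.starProjection_apply_mem _ _) (Submodule.smul_mem _ _ (mfderiv_mem_rangeSpace _))
  obtain ⟨Y, hYz, hY, hYh⟩ := exists_horizontal_field hF.riemannian hzm
  have h1 := pullbackCov_inner_eq_neg (hη q).mdiffAlongAt
    ((hY q).mfderiv_map hF.riemannian.smooth).mdiffAlongAt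
    (Filter.Eventually.of_forall fun p =>
      Submodule.inner_left_of_mem_orthogonal (mfderiv_mem_rangeSpace (Y p)) (hηn p)) (X q)
  rw [pullbackCov_mfderiv, hF.secondFundForm_eq hR hX hY hXh hYh, inner_add_right,
    Submodule.inner_left_of_mem_orthogonal (mfderiv_mem_rangeSpace _) (hηn q), add_zero,
    inner_neg_right, neg_neg, real_inner_smul_right] at h1
  have h2 : inner ℝ (tanPart I J F q (pullbackCov I J F η q (X q))) z
      = inner ℝ (pullbackCov I J F η q (X q)) z := by
    rw [tanPart, Submodule.inner_starProjection_left_eq_right,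
      Submodule.starProjection_eq_self_iff.2 hzm]
  rw [← inner_self_eq_zero (𝕜 := ℝ)]
  nth_rewrite 1 [hz]
  rw [inner_sub_left, h2, real_inner_smul_left, ← hYz, h1, hF.riemannian.inner_mfderiv (hYh q)]
  ring

end Clairaut
end RiemannianMaps

section Main
variable {E : Type*} [NormedAddCommGroup E] [NormedSpace ℝ E] [FiniteDimensional ℝ E]
  {H : Type*} [TopologicalSpace H] {I : ModelWithCorners ℝ E H}
  {M : Type*} [TopologicalSpace M] [ChartedSpace H M] [IsManifold I ∞ M]
  [RiemannianBundle (fun x : M => TangentSpace I x)]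
  [IsContMDiffRiemannianBundle I ∞ E (fun x : M => TangentSpace I x)]
  {E' : Type*} [NormedAddCommGroup E'] [NormedSpace ℝ E'] [FiniteDimensional ℝ E']
  {H' : Type*} [TopologicalSpace H'] {J : ModelWithCorners ℝ E' H'}
  {N : Type*} [TopologicalSpace N] [ChartedSpace H' N] [IsManifold J ∞ N]
  [RiemannianBundle (fun y : N => TangentSpace J y)]
  [IsContMDiffRiemannianBundle J ∞ E' (fun y : N => TangentSpace J y)]
  {F : M → N} {q : M} {X Y Z : Π q : M, TangentSpace I q}

theorem tanPart_add_norPart (v : TangentSpace J (F q)) :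
    tanPart I J F q v + norPart I J F q v = v :=
  Submodule.starProjection_add_starProjection_orthogonal v

theorem isSmoothFieldOn_univ_iff :
    IsSmoothFieldOn I X univ ↔ ∀ p, SmoothAlongAt I I (fun p => p) X p :=
  contMDiffOn_univ

theorem secondFundForm_of_vertical (hF : ContMDiff I J ∞ F)
    (hY : ∀ p, SmoothAlongAt I I (fun p => p) Y p) (hYv : ∀ p, Y p ∈ kerSpace I J F p) :
    secondFundForm I J F X Y q = - mfderiv I J F q (leviCivita I M Y q (X q)) := by
  have hYF := ((hY q).mfderiv_map hF).mdiffAlongAt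
  have h := pullbackCov_sub hYF hYF (X q)
  have h' : pullbackCov I J F (fun p => mfderiv I J F p (Y p)) q (X q) = 0 := by
    rw [← sub_self (pullbackCov I J F (fun p => mfderiv I J F p (Y p)) q (X q)), ← h]
    exact congrArg (fun L => L (X q)) (pullbackCov_congr
      (τ := fun p => mfderiv I J F p (Y p)) (hYF.sub hYF)
      (Filter.Eventually.of_forall fun p => by rw [mem_kerSpace.1 (hYv p), sub_self]))
  rw [secondFundForm, h', zero_sub]

theorem leviCivita_mem_horSpace_of_isTotallyGeodesicMap [T2Space M] (hF : IsRiemannianMap I J F)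
    (hT : IsTotallyGeodesicMap I J F) :
    IsTotallyGeodesicOn I (horSpace I J F) univ := by
  intro X Y hX hXh hY hYh q _
  rw [isSmoothFieldOn_univ_iff] at hX hY
  refine (Submodule.mem_orthogonal _ _).2 fun k hk => ?_
  obtain ⟨K, rfl, hK, hKv⟩ := exists_vertical_field hF hk
  have h1 := leviCivita_inner_eq_neg (hK q).mdiffAlongAt (hY q).mdiffAlongAt (c := 0)
    (Filter.Eventually.of_forall fun p =>
      Submodule.inner_right_of_mem_orthogonal (hKv p) (hYh p trivial)) (X q)
  have h2 := hT X K (isSmoothFieldOn_univ_iff.2 hX) (isSmoothFieldOn_univ_iff.2 hK) q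
  rw [secondFundForm_of_vertical hF.smooth hK hKv, neg_eq_zero] at h2
  rw [Submodule.inner_right_of_mem_orthogonal (mem_kerSpace.2 h2) (hYh q trivial)] at h1
  linarith

theorem leviCivita_mem_kerSpace_of_isTotallyGeodesicMap (hF : IsRiemannianMap I J F)
    (hT : IsTotallyGeodesicMap I J F) :
    IsTotallyGeodesicOn I (kerSpace I J F) univ := by
  intro X Y hX hXv hY hYv q _
  have h2 := hT X Y hX hY q
  rw [secondFundForm_of_vertical hF.smooth (isSmoothFieldOn_univ_iff.1 hY)
    fun p => hYv p trivial, neg_eq_zero] at h2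
  exact mem_kerSpace.2 h2

theorem isTotallyGeodesicMap_of [T2Space M] (hF : IsRiemannianMap I J F)
    (hk : IsTotallyGeodesicOn I (kerSpace I J F) univ)
    (hh : IsTotallyGeodesicOn I (horSpace I J F) univ)
    (h0 : ∀ X Y : Π q : M, TangentSpace I q, (∀ p, SmoothAlongAt I I (fun p => p) X p) →
      (∀ p, SmoothAlongAt I I (fun p => p) Y p) → (∀ p, X p ∈ horSpace I J F p) →
      (∀ p, Y p ∈ horSpace I J F p) → ∀ q, secondFundForm I J F X Y q = 0) :
    IsTotallyGeodesicMap I J F := by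
  have hvv : ∀ X Y : Π q : M, TangentSpace I q, (∀ p, SmoothAlongAt I I (fun p => p) X p) →
      (∀ p, SmoothAlongAt I I (fun p => p) Y p) → (∀ p, X p ∈ kerSpace I J F p) →
      (∀ p, Y p ∈ kerSpace I J F p) → ∀ q, secondFundForm I J F X Y q = 0 := by
    intro X Y hX hY hXv hYv q
    rw [secondFundForm_of_vertical hF.smooth hY hYv, mem_kerSpace.1 (hk X Y
      (isSmoothFieldOn_univ_iff.2 hX) (fun p _ => hXv p) (isSmoothFieldOn_univ_iff.2 hY)
      (fun p _ => hYv p) q trivial), neg_zero]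
  have hhv : ∀ X Y : Π q : M, TangentSpace I q, (∀ p, SmoothAlongAt I I (fun p => p) X p) →
      (∀ p, SmoothAlongAt I I (fun p => p) Y p) → (∀ p, X p ∈ horSpace I J F p) →
      (∀ p, Y p ∈ kerSpace I J F p) → ∀ q, secondFundForm I J F X Y q = 0 := by
    intro X Y hX hY hXh hYv q
    rw [secondFundForm_of_vertical hF.smooth hY hYv, neg_eq_zero]
    obtain ⟨Z, hZq, hZ, hZh⟩ := exists_horizontal_field hF
      (mfderiv_mem_rangeSpace (J := J) (F := F) (leviCivita I M Y q (X q)))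
    rw [← inner_self_eq_zero (𝕜 := ℝ)]
    nth_rewrite 2 [← hZq]
    rw [hF.inner_mfderiv (hZh q), leviCivita_inner_eq_neg (hY q).mdiffAlongAt (hZ q).mdiffAlongAt
      (c := 0) (Filter.Eventually.of_forall fun p =>
        Submodule.inner_right_of_mem_orthogonal (hYv p) (hZh p)), neg_eq_zero]
    exact Submodule.inner_right_of_mem_orthogonal (hYv q) (hh X Z (isSmoothFieldOn_univ_iff.2 hX)
      (fun p _ => hXh p) (isSmoothFieldOn_univ_iff.2 hZ) (fun p _ => hZh p) q trivial)
  intro X Y hX hY q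
  rw [isSmoothFieldOn_univ_iff] at hX hY
  have hs := hF.smooth
  let Xh : Π p : M, TangentSpace I p := fun p => adjDeriv I J F p (mfderiv I J F p (X p))
  let Yh : Π p : M, TangentSpace I p := fun p => adjDeriv I J F p (mfderiv I J F p (Y p))
  have hXh : ∀ p, SmoothAlongAt I I (fun p => p) Xh p := fun p =>
    smoothAlongAt_adjDeriv hs ((hX p).mfderiv_map hs)
  have hYh : ∀ p, SmoothAlongAt I I (fun p => p) Yh p := fun p =>
    smoothAlongAt_adjDeriv hs ((hY p).mfderiv_map hs)
  have hXv : ∀ p, SmoothAlongAt I I (fun p => p) (fun p => X p - Xh p) p := fun p =>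
    (hX p).sub (hXh p)
  have hYv : ∀ p, SmoothAlongAt I I (fun p => p) (fun p => Y p - Yh p) p := fun p =>
    (hY p).sub (hYh p)
  have mXh : ∀ p, Xh p ∈ horSpace I J F p := fun p => adjDeriv_mem_horSpace _
  have mYh : ∀ p, Yh p ∈ horSpace I J F p := fun p => adjDeriv_mem_horSpace _
  have mXv : ∀ p, X p - Xh p ∈ kerSpace I J F p := fun p => hF.sub_adjDeriv_mem_kerSpace _
  have mYv : ∀ p, Y p - Yh p ∈ kerSpace I J F p := fun p => hF.sub_adjDeriv_mem_kerSpace _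
  have eX : X = fun p => Xh p + (X p - Xh p) := by ext p; simp
  have eY : Y = fun p => Yh p + (Y p - Yh p) := by ext p; simp
  have hX' : ∀ p, SmoothAlongAt I I (fun p => p) (fun p => Xh p + (X p - Xh p)) p := fun p =>
    (hXh p).add (hXv p)
  rw [eX, eY, secondFundForm_add_right hs hYh hYv, secondFundForm_add_left hs hYh hXh hXv,
    secondFundForm_add_left hs hYv hXh hXv, h0 _ _ hXh hYh mXh mYh, hhv _ _ hXh hYv mXh mYv,
    hvv _ _ hXv hYv mXv mYv, secondFundForm_comm hs hXv hYh, hhv _ _ hYh hXv mYh mXv]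
  simp

/-- A smooth subbundle has a global smooth section through each of its vectors. -/
theorem IsSmoothSubbundleOn.exists_section [T2Space M]
    {S : Π q : M, Submodule ℝ (TangentSpace J (F q))}
    (hS : IsSmoothSubbundleOn I J F S univ) (hF : ContMDiff I J ∞ F) {u : TangentSpace J (F q)}
    (hu : u ∈ S q) :
    ∃ σ : Π q : M, TangentSpace J (F q), σ q = u ∧ (∀ p, SmoothAlongAt I J F σ p) ∧
      ∀ p, σ p ∈ S p := by
  obtain ⟨U, hU, hq, k, e, he, heS⟩ := hS q (mem_univ q)
  rw [(heS q hq).2] at hu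
  obtain ⟨c, hc⟩ := (Submodule.mem_span_range_iff_exists_fun ℝ).1 hu
  obtain ⟨ψ, h1, h0, hψ⟩ := exists_cutoff (I := I) (J := J) hF (hU.mem_nhds hq)
  refine ⟨fun p => ψ p • ∑ i, c i • e i p, by simp [h1.self_of_nhds, hc],
    hψ (fun p => ∑ i, c i • e i p) fun p hp => SmoothAlongAt.sum _ (hF p) fun i _ =>
      ((he i).smoothAlongAt (hU.mem_nhds hp)).smul contMDiffAt_const, fun p => ?_⟩
  by_cases hp : p ∈ U
  · refine Submodule.smul_mem _ _ (Submodule.sum_mem _ fun i _ => Submodule.smul_mem _ _ ?_)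
    rw [(heS p hp).2]
    exact Submodule.subset_span ⟨i, rfl⟩
  · simp [h0 p hp]

section Clairaut
variable {P : Π y : N, TangentSpace J y →L[ℝ] TangentSpace J y}
  {D₁ D₂ : Π q : M, Submodule ℝ (TangentSpace J (F q))}
  {W : Set N} {R : Π y : N, Submodule ℝ (TangentSpace J y)} {f : N → ℝ}
  [T2Space M] [T2Space N] [J.Boundaryless]

theorem IsCSIRM.gradient_eq_zero_of_isTotallyGeodesicMap (hF : IsCSIRM I J P F D₁ D₂ W R f)
    (hR : IsTotallyGeodesicOn J (fun y => (R y)ᗮ) W) (hT : IsTotallyGeodesicMap I J F) (q : M) :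
    gradient J f (F q) = 0 := by
  obtain ⟨w, hw, hw0⟩ := (Submodule.ne_bot_iff _).1
    (Submodule.one_le_finrank_iff.1 (hF.riemannian.rank_pos q))
  obtain ⟨X, hXw, hX, hXh⟩ := exists_horizontal_field hF.riemannian hw
  have h := hF.secondFundForm_self hR hX hXh q
  rw [hT X X (isSmoothFieldOn_univ_iff.2 hX) (isSmoothFieldOn_univ_iff.2 hX) q, eq_comm,
    neg_eq_zero] at h
  refine (smul_eq_zero.1 h).resolve_left fun h0 => hw0 ?_
  rw [← hXw, inner_self_eq_zero.1 h0, map_zero]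

theorem IsCSIRM.structure_identity (hF : IsCSIRM I J P F D₁ D₂ W R f)
    (hR : IsTotallyGeodesicOn J (fun y => (R y)ᗮ) W)
    (hX : ∀ p, SmoothAlongAt I I (fun p => p) X p) (hY : ∀ p, SmoothAlongAt I I (fun p => p) Y p)
    (hZ : ∀ p, SmoothAlongAt I I (fun p => p) Z p)
    (hXh : ∀ p, X p ∈ horSpace I J F p) (hYh : ∀ p, Y p ∈ horSpace I J F p)
    (hZh : ∀ p, Z p ∈ horSpace I J F p)
    (hZY : ∀ q, mfderiv I J F q (Z q) = phi I J P F q (mfderiv I J F q (Y q))) (q : M) :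
    phi I J P F q (mfderiv I J F q (leviCivita I M Z q (X q)))
      + omega I J P F q (mfderiv I J F q (leviCivita I M Z q (X q)))
      + opB I J P F q (normalCov I J F (fun p => omega I J P F p (mfderiv I J F p (Y p))) q (X q))
      + opC I J P F q (normalCov I J F (fun p => omega I J P F p (mfderiv I J F p (Y p))) q (X q))
      + mfderiv I J F q (leviCivita I M Y q (X q))
    = inner ℝ (X q) (Z q) •
        (opB I J P F q (gradient J f (F q)) + opC I J P F q (gradient J f (F q)))
      + inner ℝ (X q) (Y q) • gradient J f (F q)
      - inner ℝ (omega I J P F q (mfderiv I J F q (Y q))) (gradient J f (F q)) •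
        P (F q) (mfderiv I J F q (X q)) := by
  have hs := hF.riemannian.smooth
  have hη : ∀ p, omega I J P F p (mfderiv I J F p (Y p))
      = P (F p) (mfderiv I J F p (Y p)) - mfderiv I J F p (Z p) := fun p => by
    rw [hZY, eq_sub_iff_add_eq, add_comm]
    exact tanPart_add_norPart _
  have hPY : ∀ p, SmoothAlongAt I J F (fun p => P (F p) (mfderiv I J F p (Y p))) p := fun p =>
    ((hY p).mfderiv_map hs).clm_apply hF.kahler.smooth
  have hηs : ∀ p, SmoothAlongAt I J F (fun p => omega I J P F p (mfderiv I J F p (Y p))) p :=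
    fun p => ((hPY p).sub ((hZ p).mfderiv_map hs)).congr (Filter.Eventually.of_forall hη)
  have h1 := hF.tanPart_pullbackCov hR hX hXh hηs
    (fun p => Submodule.starProjection_apply_mem _ _) q
  have h2 : pullbackCov I J F (fun p => omega I J P F p (mfderiv I J F p (Y p))) q (X q)
      = P (F q) (-(inner ℝ (X q) (Y q) • gradient J f (F q))
          + mfderiv I J F q (leviCivita I M Y q (X q)))
        - (-(inner ℝ (X q) (Z q) • gradient J f (F q))
          + mfderiv I J F q (leviCivita I M Z q (X q))) := by
    rw [pullbackCov_congr ((hPY q).sub ((hZ q).mfderiv_map hs)).mdiffAlongAt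
      (Filter.Eventually.of_forall hη), pullbackCov_sub (hPY q).mdiffAlongAt
      ((hZ q).mfderiv_map hs).mdiffAlongAt, pullbackCov_clm_apply hF.kahler
      ((hY q).mfderiv_map hs).mdiffAlongAt, pullbackCov_mfderiv, pullbackCov_mfderiv,
      hF.secondFundForm_eq hR hX hY hXh hYh, hF.secondFundForm_eq hR hX hZ hXh hZh]
  have h3 : normalCov I J F (fun p => omega I J P F p (mfderiv I J F p (Y p))) q (X q)
      = pullbackCov I J F (fun p => omega I J P F p (mfderiv I J F p (Y p))) q (X q)
        - inner ℝ (omega I J P F q (mfderiv I J F q (Y q))) (gradient J f (F q)) •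
          mfderiv I J F q (X q) := by
    rw [← h1, eq_sub_iff_add_eq, add_comm]
    exact tanPart_add_norPart _
  have hBC : ∀ v, opB I J P F q v + opC I J P F q v = P (F q) v := fun v => tanPart_add_norPart _
  have hpo : ∀ v, phi I J P F q v + omega I J P F q v = P (F q) v := fun v => tanPart_add_norPart _
  rw [hpo, add_assoc (P (F q) _), hBC, hBC, h3, h2]
  simp only [map_sub, map_add, map_neg, map_smul, hF.kahler.sq]
  module

theorem IsCSIRM.gradient_eq_zero_of_forall (hF : IsCSIRM I J P F D₁ D₂ W R f)
    (hD₂ : ∀ q, 1 < Module.finrank ℝ (D₂ q))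
    (h : ∀ X Y Z : Π q : M, TangentSpace I q, (∀ p, SmoothAlongAt I I (fun p => p) X p) →
      (∀ p, SmoothAlongAt I I (fun p => p) Y p) → (∀ p, SmoothAlongAt I I (fun p => p) Z p) →
      (∀ p, X p ∈ horSpace I J F p) → (∀ p, Y p ∈ horSpace I J F p) →
      (∀ p, Z p ∈ horSpace I J F p) →
      (∀ q, mfderiv I J F q (Z q) = phi I J P F q (mfderiv I J F q (Y q))) → ∀ q,
      inner ℝ (X q) (Y q) • gradient J f (F q)
        = inner ℝ (omega I J P F q (mfderiv I J F q (Y q))) (gradient J f (F q)) •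
          P (F q) (mfderiv I J F q (X q))) (q : M) :
    gradient J f (F q) = 0 := by
  have hs := hF.riemannian.smooth
  have hsub : ∀ p, D₂ p ≤ rangeSpace I J F p := fun p => by
    rw [← hF.semiInvariant.sup_eq]; exact le_sup_right
  have key : ∀ u ∈ D₂ q, ∀ v ∈ D₂ q, inner ℝ v u • gradient J f (F q)
      = inner ℝ (P (F q) u) (gradient J f (F q)) • P (F q) v := by
    intro u hu v hv
    obtain ⟨σ, hσu, hσ, hσD⟩ := hF.semiInvariant.smooth₂.exists_section hs hu
    obtain ⟨X, hXv, hX, hXh⟩ := exists_horizontal_field hF.riemannian (hsub q hv)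
    have hY : ∀ p, mfderiv I J F p (adjDeriv I J F p (σ p)) = σ p := fun p =>
      hF.riemannian.mfderiv_adjDeriv (hsub p (hσD p))
    have hP : ∀ p, P (F p) (σ p) ∈ (rangeSpace I J F p)ᗮ := fun p =>
      hF.semiInvariant.map₂ p (Submodule.mem_map_of_mem (hσD p))
    have h1 := h X (fun p => adjDeriv I J F p (σ p)) (fun p => 0) hX
      (fun p => smoothAlongAt_adjDeriv hs (hσ p))
      (fun p => smoothAlongAt_zero contMDiffAt_id) hXh (fun p => adjDeriv_mem_horSpace _)
      (fun p => Submodule.zero_mem _) (fun p => by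
        rw [hY, map_zero, phi, tanPart, (Submodule.starProjection_apply_eq_zero_iff _).2 (hP p)]) q
    rw [inner_adjDeriv, hY, hXv, hσu] at h1
    rw [h1, omega, norPart, ← hσu, Submodule.starProjection_eq_self_iff.2 (hP q)]
  obtain ⟨u, hu, hu0⟩ := (Submodule.ne_bot_iff _).1
    (Submodule.one_le_finrank_iff.1 (hD₂ q).le)
  obtain ⟨v, hv, hvu⟩ : ∃ v ∈ D₂ q, v ∉ Submodule.span ℝ {u} := by
    by_contra! hcon
    have := Submodule.finrank_mono hcon
    rw [finrank_span_singleton hu0] at this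
    exact absurd (hD₂ q) (not_lt.2 this)
  have huu : inner ℝ u u ≠ 0 := inner_self_ne_zero.2 hu0
  set v' := v - (inner ℝ v u / inner ℝ u u) • u with hv'
  have hv'D : v' ∈ D₂ q := Submodule.sub_mem _ hv (Submodule.smul_mem _ _ hu)
  have hv'0 : v' ≠ 0 := fun h0 => hvu (by
    rw [sub_eq_zero.1 h0]
    exact Submodule.smul_mem _ _ (Submodule.mem_span_singleton_self u))
  have hort : inner ℝ v' u = 0 := by
    rw [hv', inner_sub_left, real_inner_smul_left, div_mul_cancel₀ _ huu, sub_self]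
  have hP0 : P (F q) v' ≠ 0 := fun h0 => hv'0 (by
    have := hF.kahler.sq (F q) v'
    rwa [h0, map_zero, eq_comm, neg_eq_zero] at this)
  have h1 := key u hu v' hv'D
  rw [hort, zero_smul, eq_comm] at h1
  have h2 := key u hu u hu
  rw [(smul_eq_zero.1 h1).resolve_right hP0, zero_smul] at h2
  exact (smul_eq_zero.1 h2).resolve_left huu

end Clairaut
end Main

end
end RiemGeom

theorem mainTheorem3 {m n : ℕ}
    {M : Type*} [TopologicalSpace M] [T2Space M] [SecondCountableTopology M]
    [ChartedSpace (EuclideanSpace ℝ (Fin m)) M] [IsManifold (𝓡 m) ∞ M]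
    [RiemannianBundle (fun x : M => TangentSpace (𝓡 m) x)]
    [IsContMDiffRiemannianBundle (𝓡 m) ∞ (EuclideanSpace ℝ (Fin m))
      (fun x : M => TangentSpace (𝓡 m) x)]
    {N : Type*} [TopologicalSpace N] [T2Space N] [SecondCountableTopology N]
    [ChartedSpace (EuclideanSpace ℝ (Fin n)) N] [IsManifold (𝓡 n) ∞ N]
    [RiemannianBundle (fun y : N => TangentSpace (𝓡 n) y)]
    [IsContMDiffRiemannianBundle (𝓡 n) ∞ (EuclideanSpace ℝ (Fin n))
      (fun y : N => TangentSpace (𝓡 n) y)]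
    (P : Π y : N, TangentSpace (𝓡 n) y →L[ℝ] TangentSpace (𝓡 n) y) (F : M → N)
    (D₁ D₂ : Π q : M, Submodule ℝ (TangentSpace (𝓡 n) (F q)))
    (W : Set N) (R : Π y : N, Submodule ℝ (TangentSpace (𝓡 n) y)) (f : N → ℝ)
    (hF : RiemGeom.IsCSIRM (𝓡 m) (𝓡 n) P F D₁ D₂ W R f)
    (hR : RiemGeom.IsTotallyGeodesicOn (𝓡 n) (fun y => (R y)ᗮ) W)
    (hD₂ : ∀ q, 1 < Module.finrank ℝ (D₂ q)) :
    RiemGeom.IsTotallyGeodesicMap (𝓡 m) (𝓡 n) F ↔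
      RiemGeom.IsTotallyGeodesicOn (𝓡 m) (RiemGeom.kerSpace (𝓡 m) (𝓡 n) F) univ ∧
      RiemGeom.IsTotallyGeodesicOn (𝓡 m) (RiemGeom.horSpace (𝓡 m) (𝓡 n) F) univ ∧
      ∀ X Y Z : Π q : M, TangentSpace (𝓡 m) q,
        RiemGeom.IsSmoothFieldOn (𝓡 m) X univ → RiemGeom.IsSmoothFieldOn (𝓡 m) Y univ →
        RiemGeom.IsSmoothFieldOn (𝓡 m) Z univ →
        (∀ q, X q ∈ RiemGeom.horSpace (𝓡 m) (𝓡 n) F q) →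
        (∀ q, Y q ∈ RiemGeom.horSpace (𝓡 m) (𝓡 n) F q) →
        (∀ q, Z q ∈ RiemGeom.horSpace (𝓡 m) (𝓡 n) F q) →
        (∀ q, mfderiv (𝓡 m) (𝓡 n) F q (Z q) =
          RiemGeom.phi (𝓡 m) (𝓡 n) P F q (mfderiv (𝓡 m) (𝓡 n) F q (Y q))) →
        ∀ q,
          inner ℝ (X q) (Z q) •
            (RiemGeom.opB (𝓡 m) (𝓡 n) P F q (RiemGeom.gradient (𝓡 n) f (F q))
              + RiemGeom.opC (𝓡 m) (𝓡 n) P F q (RiemGeom.gradient (𝓡 n) f (F q)))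
          = RiemGeom.phi (𝓡 m) (𝓡 n) P F q
              (mfderiv (𝓡 m) (𝓡 n) F q (RiemGeom.leviCivita (𝓡 m) M Z q (X q)))
            + RiemGeom.omega (𝓡 m) (𝓡 n) P F q
              (mfderiv (𝓡 m) (𝓡 n) F q (RiemGeom.leviCivita (𝓡 m) M Z q (X q)))
            + RiemGeom.opB (𝓡 m) (𝓡 n) P F q
              (RiemGeom.normalCov (𝓡 m) (𝓡 n) F (fun p =>
                RiemGeom.omega (𝓡 m) (𝓡 n) P F p (mfderiv (𝓡 m) (𝓡 n) F p (Y p))) q (X q))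
            + RiemGeom.opC (𝓡 m) (𝓡 n) P F q
              (RiemGeom.normalCov (𝓡 m) (𝓡 n) F (fun p =>
                RiemGeom.omega (𝓡 m) (𝓡 n) P F p (mfderiv (𝓡 m) (𝓡 n) F p (Y p))) q (X q))
            + mfderiv (𝓡 m) (𝓡 n) F q (RiemGeom.leviCivita (𝓡 m) M Y q (X q)) := by
  have hG : (∀ q, RiemGeom.gradient (𝓡 n) f (F q) = 0) → ∀ X Y : Π q : M, TangentSpace (𝓡 m) q,
      (∀ p, RiemGeom.SmoothAlongAt (𝓡 m) (𝓡 m) (fun p => p) X p) →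
      (∀ p, RiemGeom.SmoothAlongAt (𝓡 m) (𝓡 m) (fun p => p) Y p) →
      (∀ p, X p ∈ RiemGeom.horSpace (𝓡 m) (𝓡 n) F p) →
      (∀ p, Y p ∈ RiemGeom.horSpace (𝓡 m) (𝓡 n) F p) →
      ∀ q, RiemGeom.secondFundForm (𝓡 m) (𝓡 n) F X Y q = 0 :=
    fun h X Y hX hY hXh hYh q => by
      rw [hF.secondFundForm_eq hR hX hY hXh hYh, h, smul_zero, neg_zero]
  constructor
  · intro hT
    refine ⟨RiemGeom.leviCivita_mem_kerSpace_of_isTotallyGeodesicMap hF.riemannian hT,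
      RiemGeom.leviCivita_mem_horSpace_of_isTotallyGeodesicMap hF.riemannian hT,
      fun X Y Z hX hY hZ hXh hYh hZh hZY q => ?_⟩
    rw [hF.structure_identity hR (RiemGeom.isSmoothFieldOn_univ_iff.1 hX)
      (RiemGeom.isSmoothFieldOn_univ_iff.1 hY) (RiemGeom.isSmoothFieldOn_univ_iff.1 hZ) hXh hYh hZh
      hZY, hF.gradient_eq_zero_of_isTotallyGeodesicMap hR hT q, smul_zero, inner_zero_right,
      zero_smul, add_zero, sub_zero]
  · rintro ⟨hk, hh, h⟩
    refine RiemGeom.isTotallyGeodesicMap_of hF.riemannian hk hh (hG ?_)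
    refine hF.gradient_eq_zero_of_forall hD₂ fun X Y Z hX hY hZ hXh hYh hZh hZY q => ?_
    have h1 := h X Y Z (RiemGeom.isSmoothFieldOn_univ_iff.2 hX)
      (RiemGeom.isSmoothFieldOn_univ_iff.2 hY) (RiemGeom.isSmoothFieldOn_univ_iff.2 hZ) hXh hYh hZh
      hZY q
    rw [hF.structure_identity hR hX hY hZ hXh hYh hZh hZY, add_sub_assoc, left_eq_add,
      sub_eq_zero] at h1
    exact h1
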